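/- Let $k$ be a field; all algebras are unital $k$-algebras, $\otimes=\otimes_k$, and algebra maps are unital. **Definitions.** A *quasi-bialgebra* is an associative algebra $H$ with algebra maps $\Delta:H\to H\otimes H$, $\varepsilon:H\to k$ and an invertible $\Phi\in H\otimes H\otimes H$ such that, for all $h\in H$, $(id\otimes\Delta)\Delta(h)=\Phi\,(\Delta\otimes id)\Delta(h)\,\Phi^{-1}$, $(id\otimes\varepsilon)\Delta(h)=h\otimes 1$, $(\varepsilon\otimes id)\Delta(h)=1\otimes h$, $(1\otimes\Phi)(id\otimes\Delta\otimes id)(\Phi)(\Phi\otimes 1)=(id\otimes id\otimes\Delta)(\Phi)(\Delta\otimes id\otimes id)(\Phi)$ and $(id\otimes\varepsilon\otimes id)(\Phi)=1$. Write $\Delta(h)=h_1\otimes h_2$, $\Phi=X^1\otimes X^2\otimes X^3$, $\Phi^{-1}=x^1\otimes x^2\otimes x^3$. It is a *quasi-Hopf algebra* if there are an anti-automorphism $S$ of the algebra $H$ and $\alpha,\beta\in H$ with $S(h_1)\alpha h_2=\varepsilon(h)\alpha$, $h_1\beta S(h_2)=\varepsilon(h)\beta$ for all $h\in H$, and $X^1\beta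 S(X^2)\alpha X^3=1$, $S(x^1)\alpha x^2\beta S(x^3)=1$. Put $q^1\otimes q^2=X^1\otimes S^{-1}(\alpha X^3)X^2$. A *right $H$-comodule algebra* is an associative algebra $B$ with an algebra map $\rho:B\to B\otimes H$, $\rho(b)=b_{(0)}\otimes b_{(1)}$, and an invertible $\Phi_\rho\in B\otimes H\otimes H$ such that $\Phi_\rho(\rho\otimes id)\rho(b)=(id\otimes\Delta)\rho(b)\,\Phi_\rho$ for all $b\in B$, $(1_B\otimes\Phi)(id\otimes\Delta\otimes id)(\Phi_\rho)(\Phi_\rho\otimes 1_H)=(id\otimes id\otimes\Delta)(\Phi_\rho)(\rho\otimes id\otimes id)(\Phi_\rho)$, $(id\otimes\varepsilon)\circ\rho=id$ and $(id\otimes\varepsilon\otimes id)(\Phi_\rho)=(id\otimes id\otimes\varepsilon)(\Phi_\rho)=1_B\otimes 1_H$. A *morphism* $f:B\to B'$ of such is an algebra map with $\rho'\circ f=(f\otimes id)\circ\rho$ and $\Phi_{\rho'}=(f\otimes id\otimes id)(\Phi_\rho)$. In particular $H$ is a right $H$-comodule algebra with $\rho=\Delta$, $\Phi_\rho=\Phi$.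 A *left $H$-module algebra* is a left $H$-module $A$ with a bilinear (not necessarily associative) multiplication and a two-sided unit $1_A$ such that $(ab)c=(X^1\cdot a)\big((X^2\cdot b)(X^3\cdot c)\big)$, $h\cdot(ab)=(h_1\cdot a)(h_2\cdot b)$ and $h\cdot 1_A=\varepsilon(h)1_A$. Its *smash product* $A\# H$ is the vector space $A\otimes H$ (with $a\# h:=a\otimes h$) with multiplication $(a\# h)(a'\# h')=(x^1\cdot a)(x^2h_1\cdot a')\# x^3h_2h'$ and unit $1_A\# 1$; it is a right $H$-comodule algebra with $\rho(a\# h)=(x^1\cdot a\# x^2h_1)\otimes x^3h_2$ and $\Phi_\rho=(1_A\# X^1)\otimes X^2\otimes X^3$. **Theorem.** Let $H$ be a quasi-Hopf algebra, $(B,\rho,\Phi_\rho)$ a right $H$-comodule algebra and $v:H\to B$ a morphism of right $H$-comodule algebras. Define $E:B\to B$ by $E(b)=v(q^1)\,b_{(0)}\,v(\beta S(q^2b_{(1)}))$ and put $A=B^{co(H)}:=E(B)$. Then $$A=\{b\in B: E(b)=b\}=\{b\in B: E(b_{(0)})\otimes b_{(1)}=E(b)\otimes 1\},$$ and $A$ is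 a left $H$-module algebra with multiplication $a*a'=E(aa')$, unit $1_B$ and $H$-action $h\triangleright a=E(v(h)a)$. Moreover the map $\Psi:A\# H\to B$, $\Psi(a\# h)=a\,v(h)$, is an isomorphism of right $H$-comodule algebras. In particular, there is a left $H$-module algebra $A$ with $B\simeq A\# H$ as right $H$-comodule algebras. -/

import Mathlib

open scoped TensorProduct

namespace QuasiHopf

section TensorLegs

variable {k H B : Type*} [Field k] [Ring H] [Algebra k H] [Ring B] [Algebra k B]

/-- `x ↦ 1 ⊗ x`, from `H ⊗ H ⊗ H` to `B ⊗ H ⊗ H ⊗ H`. -/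
noncomputable def oneTensor (k H B : Type*) [Field k] [Ring H] [Algebra k H] [Ring B]
    [Algebra k B] : H ⊗[k] (H ⊗[k] H) →ₐ[k] B ⊗[k] (H ⊗[k] (H ⊗[k] H)) :=
  Algebra.TensorProduct.includeRight

/-- `x ↦ x ⊗ 1`, from `B ⊗ H ⊗ H` to `B ⊗ H ⊗ H ⊗ H`. -/
noncomputable def tensorOne (k H B : Type*) [Field k] [Ring H] [Algebra k H] [Ring B]
    [Algebra k B] : B ⊗[k] (H ⊗[k] H) →ₐ[k] B ⊗[k] (H ⊗[k] (H ⊗[k] H)) :=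
  ((Algebra.TensorProduct.map (AlgHom.id k B)
      (Algebra.TensorProduct.assoc k k k H H H).toAlgHom).comp
    (Algebra.TensorProduct.assoc k k k B (H ⊗[k] H) H).toAlgHom).comp
    Algebra.TensorProduct.includeLeft

/-- `f ⊗ id ⊗ id`, from `B ⊗ H ⊗ H` to `B ⊗ H ⊗ H ⊗ H`, for `f : B → B ⊗ H`. -/
noncomputable def firstLeg (f : B →ₐ[k] B ⊗[k] H) :
    B ⊗[k] (H ⊗[k] H) →ₐ[k] B ⊗[k] (H ⊗[k] (H ⊗[k] H)) :=
  (Algebra.TensorProduct.assoc k k k B H (H ⊗[k] H)).toAlgHom.comp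
    (Algebra.TensorProduct.map f (AlgHom.id k (H ⊗[k] H)))

/-- `id ⊗ D ⊗ id`, from `B ⊗ H ⊗ H` to `B ⊗ H ⊗ H ⊗ H`, for `D : H → H ⊗ H`. -/
noncomputable def middleLeg (B : Type*) [Ring B] [Algebra k B] (D : H →ₐ[k] H ⊗[k] H) :
    B ⊗[k] (H ⊗[k] H) →ₐ[k] B ⊗[k] (H ⊗[k] (H ⊗[k] H)) :=
  Algebra.TensorProduct.map (AlgHom.id k B)
    ((Algebra.TensorProduct.assoc k k k H H H).toAlgHom.comp
      (Algebra.TensorProduct.map D (AlgHom.id k H)))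

/-- `id ⊗ id ⊗ D`, from `B ⊗ H ⊗ H` to `B ⊗ H ⊗ H ⊗ H`, for `D : H → H ⊗ H`. -/
noncomputable def lastLeg (B : Type*) [Ring B] [Algebra k B] (D : H →ₐ[k] H ⊗[k] H) :
    B ⊗[k] (H ⊗[k] H) →ₐ[k] B ⊗[k] (H ⊗[k] (H ⊗[k] H)) :=
  Algebra.TensorProduct.map (AlgHom.id k B) (Algebra.TensorProduct.map (AlgHom.id k H) D)

/-- `(f ⊗ id) ∘ f`, from `B` to `B ⊗ H ⊗ H`, for `f : B → B ⊗ H`. -/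
noncomputable def iterLeft (f : B →ₐ[k] B ⊗[k] H) : B →ₐ[k] B ⊗[k] (H ⊗[k] H) :=
  ((Algebra.TensorProduct.assoc k k k B H H).toAlgHom.comp
    (Algebra.TensorProduct.map f (AlgHom.id k H))).comp f

/-- `(id ⊗ D) ∘ f`, from `B` to `B ⊗ H ⊗ H`, for `f : B → B ⊗ H` and `D : H → H ⊗ H`. -/
noncomputable def iterRight (D : H →ₐ[k] H ⊗[k] H) (f : B →ₐ[k] B ⊗[k] H) :
    B →ₐ[k] B ⊗[k] (H ⊗[k] H) :=
  (Algebra.TensorProduct.map (AlgHom.id k B) D).comp f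

end TensorLegs

/-- A quasi-bialgebra structure on a `k`-algebra `H`. The threefold tensor power is bracketed
as `H ⊗ (H ⊗ H)`. -/
structure QuasiBialgebra (k H : Type*) [Field k] [Ring H] [Algebra k H] where
  /-- the comultiplication `Δ` -/
  comul : H →ₐ[k] H ⊗[k] H
  /-- the counit `ε` -/
  counit : H →ₐ[k] k
  /-- the reassociator `Φ` -/
  reassoc : (H ⊗[k] (H ⊗[k] H))ˣ
  quasi_coassoc : ∀ h : H, iterRight comul comul h =
    (reassoc : H ⊗[k] (H ⊗[k] H)) * iterLeft comul h *
      ((reassoc⁻¹ : (H ⊗[k] (H ⊗[k] H))ˣ) : H ⊗[k] (H ⊗[k] H))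
  id_counit : ∀ h : H,
    Algebra.TensorProduct.map (AlgHom.id k H) counit (comul h) = h ⊗ₜ[k] (1 : k)
  counit_id : ∀ h : H,
    Algebra.TensorProduct.map counit (AlgHom.id k H) (comul h) = (1 : k) ⊗ₜ[k] h
  pentagon :
    oneTensor k H H (reassoc : H ⊗[k] (H ⊗[k] H)) * middleLeg H comul reassoc *
        tensorOne k H H reassoc =
      lastLeg H comul reassoc * firstLeg comul reassoc
  id_counit_id : Algebra.TensorProduct.map (AlgHom.id k H)
    (Algebra.TensorProduct.map counit (AlgHom.id k H)) (reassoc : H ⊗[k] (H ⊗[k] H)) = 1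

/-- A quasi-Hopf algebra structure on a `k`-algebra `H`: a quasi-bialgebra with an algebra
anti-automorphism `S` and elements `α`, `β`. -/
structure QuasiHopfAlgebra (k H : Type*) [Field k] [Ring H] [Algebra k H] extends
    QuasiBialgebra k H where
  /-- the antipode `S` -/
  antipode : H ≃ₗ[k] H
  antipode_one : antipode 1 = 1
  antipode_mul : ∀ g h : H, antipode (g * h) = antipode h * antipode g
  /-- the element `α` -/
  alpha : H
  /-- the element `β` -/
  beta : H
  /-- `S(h₁) α h₂ = ε(h) α` -/
  antipode_alpha : ∀ h : H, LinearMap.mul' k H (TensorProduct.map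
    (LinearMap.mulRight k alpha ∘ₗ antipode.toLinearMap) LinearMap.id (comul h)) =
      counit h • alpha
  /-- `h₁ β S(h₂) = ε(h) β` -/
  beta_antipode : ∀ h : H, LinearMap.mul' k H (TensorProduct.map
    (LinearMap.mulRight k beta) antipode.toLinearMap (comul h)) = counit h • beta
  /-- `X¹ β S(X²) α X³ = 1`, where `Φ = X¹ ⊗ X² ⊗ X³` -/
  reassoc_antipode : LinearMap.mul' k H (TensorProduct.map (LinearMap.mulRight k beta)
    (LinearMap.mul' k H ∘ₗ TensorProduct.map
      (LinearMap.mulRight k alpha ∘ₗ antipode.toLinearMap) LinearMap.id)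
    (reassoc : H ⊗[k] (H ⊗[k] H))) = 1
  /-- `S(x¹) α x² β S(x³) = 1`, where `Φ⁻¹ = x¹ ⊗ x² ⊗ x³` -/
  reassoc_inv_antipode : LinearMap.mul' k H (TensorProduct.map
    (LinearMap.mulRight k alpha ∘ₗ antipode.toLinearMap)
    (LinearMap.mul' k H ∘ₗ TensorProduct.map
      (LinearMap.mulRight k beta) antipode.toLinearMap)
    ((reassoc⁻¹ : (H ⊗[k] (H ⊗[k] H))ˣ) : H ⊗[k] (H ⊗[k] H))) = 1

/-- A right `H`-comodule algebra structure on a unital associative `k`-algebra `B`. -/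
structure ComoduleAlgebra {k H : Type*} [Field k] [Ring H] [Algebra k H]
    (Q : QuasiBialgebra k H) (B : Type*) [Ring B] [Algebra k B] where
  /-- the coaction `ρ` -/
  coact : B →ₐ[k] B ⊗[k] H
  /-- the element `Φ_ρ` -/
  reassoc : (B ⊗[k] (H ⊗[k] H))ˣ
  quasi_coassoc : ∀ b : B,
    (reassoc : B ⊗[k] (H ⊗[k] H)) * iterLeft coact b = iterRight Q.comul coact b * reassoc
  pentagon :
    oneTensor k H B (Q.reassoc : H ⊗[k] (H ⊗[k] H)) * middleLeg B Q.comul reassoc *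
        tensorOne k H B reassoc =
      lastLeg B Q.comul reassoc * firstLeg coact reassoc
  id_counit : ∀ b : B,
    Algebra.TensorProduct.map (AlgHom.id k B) Q.counit (coact b) = b ⊗ₜ[k] (1 : k)
  id_counit_id : Algebra.TensorProduct.map (AlgHom.id k B)
    (Algebra.TensorProduct.map Q.counit (AlgHom.id k H)) (reassoc : B ⊗[k] (H ⊗[k] H)) = 1
  id_id_counit : Algebra.TensorProduct.map (AlgHom.id k B)
    (Algebra.TensorProduct.map (AlgHom.id k H) Q.counit) (reassoc : B ⊗[k] (H ⊗[k] H)) = 1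

/-- An algebra map is a morphism of right `H`-comodule algebras if it intertwines the coactions
and maps `Φ_ρ` to `Φ_ρ'`. -/
structure IsComoduleAlgebraHom {k H B B' : Type*} [Field k] [Ring H] [Algebra k H]
    [Ring B] [Algebra k B] [Ring B'] [Algebra k B'] {Q : QuasiBialgebra k H}
    (C : ComoduleAlgebra Q B) (C' : ComoduleAlgebra Q B') (f : B →ₐ[k] B') : Prop where
  map_coact : ∀ b : B,
    C'.coact (f b) = Algebra.TensorProduct.map f (AlgHom.id k H) (C.coact b)
  map_reassoc : (C'.reassoc : B' ⊗[k] (H ⊗[k] H)) =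
    Algebra.TensorProduct.map f (AlgHom.id k (H ⊗[k] H)) (C.reassoc : B ⊗[k] (H ⊗[k] H))

/-- A left `H`-module algebra structure on a `k`-vector space `A`: an `H`-module structure
together with a (generally nonassociative) bilinear multiplication and a unit. -/
structure ModuleAlgebra {k H : Type*} [Field k] [Ring H] [Algebra k H]
    (Q : QuasiBialgebra k H) (A : Type*) [AddCommGroup A] [Module k A] where
  /-- the `H`-module structure -/
  act : H →ₐ[k] Module.End k A
  /-- the multiplication -/
  mul : A →ₗ[k] A →ₗ[k] A
  /-- the unit -/
  one : A
  one_mul : ∀ a : A, mul one a = a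
  mul_one : ∀ a : A, mul a one = a
  /-- `(a b) c = (X¹ · a) ((X² · b) (X³ · c))`; here `act.toLinearMap.flip a` is the
  map `h ↦ h · a` -/
  mul_assoc : ∀ a b c : A, mul (mul a b) c =
    TensorProduct.lift mul (TensorProduct.map (act.toLinearMap.flip a)
      (TensorProduct.lift mul ∘ₗ
        TensorProduct.map (act.toLinearMap.flip b) (act.toLinearMap.flip c))
      (Q.reassoc : H ⊗[k] (H ⊗[k] H)))
  /-- `h · (a b) = (h₁ · a) (h₂ · b)` -/
  act_mul : ∀ (h : H) (a b : A), act h (mul a b) =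
    TensorProduct.lift mul (TensorProduct.map (act.toLinearMap.flip a)
      (act.toLinearMap.flip b) (Q.comul h))
  act_one : ∀ h : H, act h one = Q.counit h • one

/-- Induction on elements of a threefold tensor product. -/
lemma tensor_induction₃ {k X Y Z : Type*} [Field k] [AddCommGroup X] [Module k X]
    [AddCommGroup Y] [Module k Y] [AddCommGroup Z] [Module k Z]
    {p : X ⊗[k] (Y ⊗[k] Z) → Prop} (w : X ⊗[k] (Y ⊗[k] Z)) (zero : p 0)
    (tmul : ∀ x y z, p (x ⊗ₜ[k] (y ⊗ₜ[k] z))) (add : ∀ u v, p u → p v → p (u + v)) : p w := by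
  induction w using TensorProduct.induction_on with
  | zero => exact zero
  | add u v hu hv => exact add u v hu hv
  | tmul x w =>
    induction w using TensorProduct.induction_on with
    | zero => simpa using zero
    | add u v hu hv => simpa only [TensorProduct.tmul_add] using add _ _ hu hv
    | tmul y z => exact tmul x y z

/-- Linear maps on a threefold tensor product agree if they agree on pure tensors. -/
lemma tensor_ind₃ {k X Y Z W : Type*} [Field k] [AddCommGroup X] [Module k X]
    [AddCommGroup Y] [Module k Y] [AddCommGroup Z] [Module k Z] [AddCommGroup W] [Module k W]
    (f g : X ⊗[k] (Y ⊗[k] Z) →ₗ[k] W)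
    (h : ∀ x y z, f (x ⊗ₜ[k] (y ⊗ₜ[k] z)) = g (x ⊗ₜ[k] (y ⊗ₜ[k] z))) (w) : f w = g w := by
  induction w using tensor_induction₃ with
  | zero => simp
  | add u v hu hv => simp only [map_add, hu, hv]
  | tmul x y z => exact h x y z

section SmashProducts

set_option maxSynthPendingDepth 10

namespace QuasiBialgebra

variable {k H : Type*} [Field k] [Ring H] [Algebra k H] (Q : QuasiBialgebra k H)

/-- The components of `Φ⁻¹`. -/
noncomputable def reassocInv : H ⊗[k] (H ⊗[k] H) :=
  ((Q.reassoc⁻¹ : (H ⊗[k] (H ⊗[k] H))ˣ) : H ⊗[k] (H ⊗[k] H))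

@[simp] lemma reassoc_mul_inv : (Q.reassoc : H ⊗[k] (H ⊗[k] H)) * Q.reassocInv = 1 :=
  Q.reassoc.mul_inv

@[simp] lemma reassocInv_mul : Q.reassocInv * (Q.reassoc : H ⊗[k] (H ⊗[k] H)) = 1 :=
  Q.reassoc.inv_mul

lemma map_reassocInv_eq_one {R : Type*} [Ring R] [Algebra k R]
    (f : H ⊗[k] (H ⊗[k] H) →ₐ[k] R) (hf : f Q.reassoc = 1) : f Q.reassocInv = 1 := by
  have h := congrArg f Q.reassoc_mul_inv
  rwa [map_mul, hf, one_mul, map_one] at h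

lemma pentagon_inv :
    firstLeg Q.comul Q.reassocInv * lastLeg H Q.comul Q.reassocInv =
      tensorOne k H H Q.reassocInv * middleLeg H Q.comul Q.reassocInv *
        oneTensor k H H Q.reassocInv := by
  have h : Units.map (oneTensor k H H).toMonoidHom Q.reassoc *
      Units.map (middleLeg H Q.comul).toMonoidHom Q.reassoc *
      Units.map (tensorOne k H H).toMonoidHom Q.reassoc =
      Units.map (lastLeg H Q.comul).toMonoidHom Q.reassoc *
      Units.map (firstLeg Q.comul).toMonoidHom Q.reassoc :=
    Units.ext Q.pentagon
  have h2 := congrArg (fun u => ((u⁻¹ : (H ⊗[k] (H ⊗[k] (H ⊗[k] H)))ˣ) :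
    H ⊗[k] (H ⊗[k] (H ⊗[k] H)))) h
  simp only [mul_inv_rev, Units.val_mul] at h2
  exact h2.symm.trans (_root_.mul_assoc _ _ _).symm

lemma quasi_coassoc' (h : H) :
    (Q.reassoc : H ⊗[k] (H ⊗[k] H)) * iterLeft Q.comul h =
      iterRight Q.comul Q.comul h * Q.reassoc := by
  rw [Q.quasi_coassoc h, _root_.mul_assoc, Units.inv_mul, _root_.mul_one]

lemma iterLeft_mul_inv (h : H) :
    iterLeft Q.comul h * Q.reassocInv = Q.reassocInv * iterRight Q.comul Q.comul h := by
  rw [Q.quasi_coassoc h, reassocInv]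
  simp only [_root_.mul_assoc, Units.inv_mul_cancel_left]

/-- The algebra map `ε ⊗ id`. -/
noncomputable def epsLeft (R : Type*) [Ring R] [Algebra k R] : H ⊗[k] R →ₐ[k] R :=
  (Algebra.TensorProduct.lid k R).toAlgHom.comp
    (Algebra.TensorProduct.map Q.counit (AlgHom.id k R))

/-- The algebra map `id ⊗ ε`. -/
noncomputable def epsRight (R : Type*) [Ring R] [Algebra k R] : R ⊗[k] H →ₐ[k] R :=
  (Algebra.TensorProduct.rid k k R).toAlgHom.comp
    (Algebra.TensorProduct.map (AlgHom.id k R) Q.counit)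

@[simp] lemma epsLeft_tmul {R : Type*} [Ring R] [Algebra k R] (h : H) (r : R) :
    Q.epsLeft R (h ⊗ₜ[k] r) = Q.counit h • r := by
  simp [epsLeft]

@[simp] lemma epsRight_tmul {R : Type*} [Ring R] [Algebra k R] (h : H) (r : R) :
    Q.epsRight R (r ⊗ₜ[k] h) = Q.counit h • r := by
  simp [epsRight]

lemma epsLeft_comul (h : H) : Q.epsLeft H (Q.comul h) = h := by
  have := congrArg (Algebra.TensorProduct.lid k H) (Q.counit_id h)
  simpa [epsLeft] using this

lemma epsRight_comul (h : H) : Q.epsRight H (Q.comul h) = h := by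
  have := congrArg (Algebra.TensorProduct.rid k k H) (Q.id_counit h)
  simpa [epsRight] using this


lemma epsMiddle : Algebra.TensorProduct.map (AlgHom.id k H) (Q.epsLeft H)
    (Q.reassoc : H ⊗[k] (H ⊗[k] H)) = 1 := by
  have h := congrArg (Algebra.TensorProduct.map (AlgHom.id k H)
    (Algebra.TensorProduct.lid k H).toAlgHom) Q.id_counit_id
  rw [map_one] at h
  rw [← h]
  generalize (Q.reassoc : H ⊗[k] (H ⊗[k] H)) = x
  rw [← AlgHom.comp_apply]
  congr 1
  ext <;> simp

lemma epsLeft_assoc {R : Type*} [Ring R] [Algebra k R] (d : H ⊗[k] H) (r : R) :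
    Q.epsLeft (H ⊗[k] R) (Algebra.TensorProduct.assoc k k k H H R (d ⊗ₜ[k] r)) =
      Q.epsLeft H d ⊗ₜ[k] r := by
  induction d using TensorProduct.induction_on with
  | zero => simp
  | tmul x y => simp [TensorProduct.smul_tmul']
  | add x y hx hy => simp only [TensorProduct.add_tmul, map_add, hx, hy]

lemma map_epsLeft_assoc {R R' : Type*} [Ring R] [Algebra k R] [Ring R'] [Algebra k R']
    (d : R' ⊗[k] H) (r : R) :
    Algebra.TensorProduct.map (AlgHom.id k R') (Q.epsLeft R)
      (Algebra.TensorProduct.assoc k k k R' H R (d ⊗ₜ[k] r)) = Q.epsRight R' d ⊗ₜ[k] r := by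
  induction d using TensorProduct.induction_on with
  | zero => simp
  | tmul x y => simp [TensorProduct.smul_tmul]
  | add x y hx hy => simp only [TensorProduct.add_tmul, map_add, hx, hy]

lemma epsLeft_one : Q.epsLeft (H ⊗[k] H) (Q.reassoc : H ⊗[k] (H ⊗[k] H)) = 1 := by
  let P : H ⊗[k] (H ⊗[k] (H ⊗[k] H)) →ₐ[k] H ⊗[k] (H ⊗[k] H) :=
    Algebra.TensorProduct.map (AlgHom.id k H) (Q.epsLeft (H ⊗[k] H))
  have h1 : ∀ x, P (oneTensor k H H x) = 1 ⊗ₜ[k] Q.epsLeft (H ⊗[k] H) x := by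
    intro x
    simp [P, oneTensor]
  have h2 : ∀ x, P (middleLeg H Q.comul x) = x := by
    intro x
    induction x using tensor_induction₃ with
    | zero => simp
    | add x y hx hy => simp only [map_add, hx, hy]
    | tmul x y z =>
        simp [P, middleLeg, epsLeft_assoc, epsLeft_comul]
  have h3 : ∀ x, P (tensorOne k H H x) =
      Algebra.TensorProduct.map (AlgHom.id k H) Algebra.TensorProduct.includeLeft
        (Algebra.TensorProduct.map (AlgHom.id k H) (Q.epsLeft H) x) := by
    intro x
    induction x using tensor_induction₃ with
    | zero => simp
    | add x y hx hy => simp only [map_add, hx, hy]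
    | tmul x y z => simp [P, tensorOne]
  have h4 : ∀ x, P (lastLeg H Q.comul x) =
      Algebra.TensorProduct.map (AlgHom.id k H) Q.comul
        (Algebra.TensorProduct.map (AlgHom.id k H) (Q.epsLeft H) x) := by
    intro x
    induction x using tensor_induction₃ with
    | zero => simp
    | add x y hx hy => simp only [map_add, hx, hy]
    | tmul x y z => simp [P, lastLeg]
  have h5 : ∀ x, P (firstLeg Q.comul x) = x := by
    intro x
    induction x using TensorProduct.induction_on with
    | zero => simp
    | add x y hx hy => simp only [map_add, hx, hy]
    | tmul x y => simp [P, firstLeg, map_epsLeft_assoc, epsRight_comul]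
  have h := congrArg P Q.pentagon
  rw [map_mul, map_mul, map_mul, h1, h2, h3, h4, h5, epsMiddle, map_one, map_one,
    _root_.mul_one, _root_.one_mul] at h
  have h' := congrArg (fun x => Q.epsLeft (H ⊗[k] H) (x * Q.reassocInv)) h
  simpa [_root_.mul_assoc] using h'

lemma map_epsLeft_assoc_pair (d : H ⊗[k] H) (y z : H) :
    Algebra.TensorProduct.map (AlgHom.id k H)
      (Algebra.TensorProduct.map (AlgHom.id k H) (Q.epsLeft H))
      (Algebra.TensorProduct.assoc k k k H H (H ⊗[k] H) (d ⊗ₜ[k] (y ⊗ₜ[k] z))) =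
    Q.counit y • Algebra.TensorProduct.assoc k k k H H H (d ⊗ₜ[k] z) := by
  induction d using TensorProduct.induction_on with
  | zero => simp
  | tmul a b => simp
  | add a b ha hb => simp only [TensorProduct.add_tmul, map_add, ha, hb, smul_add]

lemma epsRight_one : Algebra.TensorProduct.map (AlgHom.id k H) (Q.epsRight H)
    (Q.reassoc : H ⊗[k] (H ⊗[k] H)) = 1 := by
  let P : H ⊗[k] (H ⊗[k] (H ⊗[k] H)) →ₐ[k] H ⊗[k] (H ⊗[k] H) :=
    Algebra.TensorProduct.map (AlgHom.id k H)
      (Algebra.TensorProduct.map (AlgHom.id k H) (Q.epsLeft H))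
  have h1 : ∀ x, P (oneTensor k H H x) =
      1 ⊗ₜ[k] Algebra.TensorProduct.map (AlgHom.id k H) (Q.epsLeft H) x := by
    intro x
    simp [P, oneTensor]
  have h2 : ∀ x, P (middleLeg H Q.comul x) = x := by
    intro x
    induction x using tensor_induction₃ with
    | zero => simp
    | add x y hx hy => simp only [map_add, hx, hy]
    | tmul x y z =>
        simp [P, middleLeg, map_epsLeft_assoc, epsRight_comul]
  have h3 : ∀ x, P (tensorOne k H H x) =
      Algebra.TensorProduct.assoc k k k H H H
        (Algebra.TensorProduct.map (AlgHom.id k H) (Q.epsRight H) x ⊗ₜ[k] 1) := by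
    intro x
    induction x using tensor_induction₃ with
    | zero => simp
    | add x y hx hy => simp only [map_add, hx, hy, TensorProduct.add_tmul]
    | tmul x y z => simp [P, tensorOne, ← TensorProduct.smul_tmul']
  have h4 : ∀ x, P (lastLeg H Q.comul x) = x := by
    intro x
    induction x using tensor_induction₃ with
    | zero => simp
    | add x y hx hy => simp only [map_add, hx, hy]
    | tmul x y z => simp [P, lastLeg, epsLeft_comul]
  have h5 : ∀ x, P (firstLeg Q.comul x) =
      Algebra.TensorProduct.assoc k k k H H H
        (Algebra.TensorProduct.map Q.comul (AlgHom.id k H)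
        (Algebra.TensorProduct.map (AlgHom.id k H) (Q.epsLeft H) x)) := by
    intro x
    induction x using tensor_induction₃ with
    | zero => simp
    | add x y hx hy => simp only [map_add, hx, hy]
    | tmul x y z => simp [P, firstLeg, map_epsLeft_assoc_pair]
  have h := congrArg P Q.pentagon
  rw [map_mul, map_mul, map_mul, h1, h2, h3, h4, h5, epsMiddle, map_one, map_one,
    _root_.mul_one, ← Algebra.TensorProduct.one_def, _root_.one_mul] at h
  have h' := congrArg (fun x => Q.epsRight (H ⊗[k] H)
    ((Algebra.TensorProduct.assoc k k k H H H).symm (Q.reassocInv * x))) h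
  simpa [← _root_.mul_assoc] using h'

@[simp] lemma epsLeft_reassocInv : Q.epsLeft (H ⊗[k] H) Q.reassocInv = 1 :=
  Q.map_reassocInv_eq_one _ Q.epsLeft_one

@[simp] lemma epsMiddle_reassocInv :
    Algebra.TensorProduct.map (AlgHom.id k H) (Q.epsLeft H) Q.reassocInv = 1 :=
  Q.map_reassocInv_eq_one _ Q.epsMiddle

@[simp] lemma epsRight_reassocInv :
    Algebra.TensorProduct.map (AlgHom.id k H) (Q.epsRight H) Q.reassocInv = 1 :=
  Q.map_reassocInv_eq_one _ Q.epsRight_one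

lemma id_id_counit : Algebra.TensorProduct.map (AlgHom.id k H)
    (Algebra.TensorProduct.map (AlgHom.id k H) Q.counit)
    (Q.reassoc : H ⊗[k] (H ⊗[k] H)) = 1 := by
  have h := congrArg (Algebra.TensorProduct.map (AlgHom.id k H)
    (Algebra.TensorProduct.rid k k H).symm.toAlgHom) Q.epsRight_one
  rw [map_one] at h
  rw [← h]
  generalize (Q.reassoc : H ⊗[k] (H ⊗[k] H)) = x
  induction x using tensor_induction₃ with
  | zero => simp
  | add x y hx hy => simp only [map_add, hx, hy]
  | tmul x y z =>
      have hz : y ⊗ₜ[k] Q.counit z = Q.counit z • (y ⊗ₜ[k] (1 : k)) := by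
        rw [← TensorProduct.tmul_smul, smul_eq_mul, _root_.mul_one]
      simp [hz]

/-- `H` as a right comodule algebra over itself, with `ρ = Δ` and `Φ_ρ = Φ`. -/
noncomputable def regular : ComoduleAlgebra Q H where
  coact := Q.comul
  reassoc := Q.reassoc
  quasi_coassoc := Q.quasi_coassoc'
  pentagon := Q.pentagon
  id_counit := Q.id_counit
  id_counit_id := Q.id_counit_id
  id_id_counit := Q.id_id_counit

end QuasiBialgebra

namespace ModuleAlgebra

variable {k H A : Type*} [Field k] [Ring H] [Algebra k H] [AddCommGroup A] [Module k A]
  {Q : QuasiBialgebra k H} (M : ModuleAlgebra Q A)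

/-- The map `h ↦ h · a`, as a linear function of `a`. -/
def orb : A →ₗ[k] H →ₗ[k] A := M.act.toLinearMap.flip

@[simp] lemma orb_apply (a : A) (h : H) : M.orb a h = M.act h a := rfl

/-- The map `w ↦ (w¹ · a) (w² · b) ⊗ w³`. -/
noncomputable def mulTensor (a b : A) : H ⊗[k] (H ⊗[k] H) →ₗ[k] A ⊗[k] H :=
  (TensorProduct.map (TensorProduct.lift M.mul) LinearMap.id ∘ₗ
    (TensorProduct.assoc k A A H).symm.toLinearMap) ∘ₗ
    TensorProduct.map (M.orb a) (TensorProduct.map (M.orb b) LinearMap.id)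

@[simp] lemma mulTensor_tmul (a b : A) (x y z : H) :
    M.mulTensor a b (x ⊗ₜ[k] (y ⊗ₜ[k] z)) = M.mul (M.act x a) (M.act y b) ⊗ₜ[k] z := rfl

lemma mulTensor_add_left (a a' b : A) :
    M.mulTensor (a + a') b = M.mulTensor a b + M.mulTensor a' b := by
  ext; simp [TensorProduct.add_tmul]

lemma mulTensor_add_right (a b b' : A) :
    M.mulTensor a (b + b') = M.mulTensor a b + M.mulTensor a b' := by
  ext; simp [TensorProduct.add_tmul]

lemma mulTensor_smul_left (c : k) (a b : A) :
    M.mulTensor (c • a) b = c • M.mulTensor a b := by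
  ext; simp [TensorProduct.smul_tmul']

lemma mulTensor_smul_right (c : k) (a b : A) :
    M.mulTensor a (c • b) = c • M.mulTensor a b := by
  ext; simp [TensorProduct.smul_tmul']

/-- The product `(a # h) (b # g) = (x¹ · a) (x² h₁ · b) # x³ h₂ g` of the smash product, where
`Φ⁻¹ = x¹ ⊗ x² ⊗ x³`. -/
noncomputable def smashMulTmul (a : A) (h : H) (b : A) (g : H) : A ⊗[k] H :=
  M.mulTensor a b (Q.reassocInv * ((1 : H) ⊗ₜ[k] (Q.comul h * ((1 : H) ⊗ₜ[k] g))))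

/-- The bilinear extension of the product of the smash product. -/
noncomputable def smashMul : A ⊗[k] H →ₗ[k] A ⊗[k] H →ₗ[k] A ⊗[k] H :=
  TensorProduct.lift (LinearMap.mk₂ k
    (fun a h => TensorProduct.lift (LinearMap.mk₂ k (fun b g => M.smashMulTmul a h b g)
      (fun _ _ _ => by simp [smashMulTmul, mulTensor_add_right])
      (fun _ _ _ => by simp [smashMulTmul, mulTensor_smul_right])
      (fun _ _ _ => by simp [smashMulTmul, TensorProduct.tmul_add, mul_add])
      (fun _ _ _ => by simp [smashMulTmul])))
    (fun _ _ _ => by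
      apply TensorProduct.ext'
      intro b g
      simp [smashMulTmul, mulTensor_add_left])
    (fun _ _ _ => by
      apply TensorProduct.ext'
      intro b g
      simp [smashMulTmul, mulTensor_smul_left])
    (fun _ _ _ => by
      apply TensorProduct.ext'
      intro b g
      simp [smashMulTmul, TensorProduct.tmul_add, mul_add, add_mul])
    (fun _ _ _ => by
      apply TensorProduct.ext'
      intro b g
      simp [smashMulTmul]))

@[simp] lemma smashMul_tmul (a : A) (h : H) (b : A) (g : H) :
    M.smashMul (a ⊗ₜ[k] h) (b ⊗ₜ[k] g) =
      M.mulTensor a b (Q.reassocInv * ((1 : H) ⊗ₜ[k] (Q.comul h * ((1 : H) ⊗ₜ[k] g)))) := rfl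

/-- The map `w ↦ (w¹ · a) ((w² · b) (w³ · c)) ⊗ w⁴`. -/
noncomputable def mulTensor₃ (a b c : A) : H ⊗[k] (H ⊗[k] (H ⊗[k] H)) →ₗ[k] A ⊗[k] H :=
  (TensorProduct.map (TensorProduct.lift M.mul) LinearMap.id ∘ₗ
    (TensorProduct.assoc k A A H).symm.toLinearMap) ∘ₗ
    TensorProduct.map (M.orb a) (M.mulTensor b c)

@[simp] lemma mulTensor₃_tmul (a b c : A) (x y z t : H) :
    M.mulTensor₃ a b c (x ⊗ₜ[k] (y ⊗ₜ[k] (z ⊗ₜ[k] t))) =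
      M.mul (M.act x a) (M.mul (M.act y b) (M.act z c)) ⊗ₜ[k] t := rfl

lemma mul_mul_tmul (a b c : A) (t : H) :
    M.mul (M.mul a b) c ⊗ₜ[k] t =
      M.mulTensor₃ a b c (tensorOne k H H Q.reassoc * (1 ⊗ₜ[k] (1 ⊗ₜ[k] (1 ⊗ₜ[k] t)))) := by
  rw [M.mul_assoc]
  generalize (Q.reassoc : H ⊗[k] (H ⊗[k] H)) = w
  induction w using tensor_induction₃ with
  | zero => simp
  | add x y hx hy => simp only [map_add, add_mul, TensorProduct.add_tmul, hx, hy]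
  | tmul x y z => simp [tensorOne]

lemma mulTensor_act_left (a b c : A) (u v : H) (Y : H ⊗[k] (H ⊗[k] H)) :
    M.mulTensor (M.mul (M.act u a) (M.act v b)) c Y =
      M.mulTensor₃ a b c (tensorOne k H H Q.reassoc * firstLeg Q.comul Y *
        (u ⊗ₜ[k] (v ⊗ₜ[k] 1))) := by
  induction Y using tensor_induction₃ with
  | zero => simp
  | add x y hx hy => simp only [map_add, add_mul, mul_add, hx, hy]
  | tmul x y z =>
      rw [mulTensor_tmul, M.act_mul]
      simp only [firstLeg, AlgHom.comp_apply, Algebra.TensorProduct.map_tmul]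
      generalize Q.comul x = D
      induction D using TensorProduct.induction_on with
      | zero => simp
      | add D D' h h' =>
        simp only [map_add, LinearMap.add_apply, TensorProduct.add_tmul, h, h', mul_add, add_mul]
      | tmul d e =>
        simp only [TensorProduct.map_tmul, TensorProduct.lift.tmul, mul_mul_tmul]
        generalize (Q.reassoc : H ⊗[k] (H ⊗[k] H)) = w
        induction w using tensor_induction₃ with
        | zero => simp
        | add x y hx hy => simp only [map_add, add_mul, hx, hy]
        | tmul p q r => simp [tensorOne]

lemma mulTensor_act_right (a b c : A) (u v : H) (Y : H ⊗[k] (H ⊗[k] H)) :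
    M.mulTensor a (M.mul (M.act u b) (M.act v c)) Y =
      M.mulTensor₃ a b c (middleLeg H Q.comul Y * (1 ⊗ₜ[k] (u ⊗ₜ[k] (v ⊗ₜ[k] 1)))) := by
  induction Y using tensor_induction₃ with
  | zero => simp
  | add x y hx hy => simp only [map_add, add_mul, hx, hy]
  | tmul x y z =>
      simp only [middleLeg, Algebra.TensorProduct.map_tmul, AlgHom.comp_apply,
        Algebra.TensorProduct.tmul_mul_tmul, mulTensor_tmul, M.act_mul]
      generalize Q.comul y = D
      induction D using TensorProduct.induction_on with
      | zero => simp
      | add D D' h h' =>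
        simp only [map_add, TensorProduct.add_tmul, h, h', add_mul, TensorProduct.tmul_add]
      | tmul d e => simp

lemma smashMul_mulTensor_left (a b c : A) (W : H ⊗[k] (H ⊗[k] H)) (g : H) :
    M.smashMul (M.mulTensor a b W) (c ⊗ₜ[k] g) =
      M.mulTensor₃ a b c (tensorOne k H H Q.reassoc * firstLeg Q.comul Q.reassocInv *
        (lastLeg H Q.comul W * (1 ⊗ₜ[k] (1 ⊗ₜ[k] (1 ⊗ₜ[k] g))))) := by
  induction W using tensor_induction₃ with
  | zero => simp
  | add x y hx hy => simp only [map_add, add_mul, mul_add, LinearMap.add_apply, hx, hy]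
  | tmul x y z =>
      rw [mulTensor_tmul, smashMul_tmul, mulTensor_act_left, map_mul (firstLeg Q.comul)]
      congr 1
      rw [_root_.mul_assoc (tensorOne k H H Q.reassoc), _root_.mul_assoc (tensorOne k H H Q.reassoc),
        _root_.mul_assoc (firstLeg Q.comul Q.reassocInv)]
      congr 2
      have h1 : ∀ X : H ⊗[k] H, firstLeg Q.comul ((1 : H) ⊗ₜ[k] X) = 1 ⊗ₜ[k] (1 ⊗ₜ[k] X) := by
        intro X
        simp [firstLeg, Algebra.TensorProduct.one_def]
      simp [h1, lastLeg]

lemma smashMul_mulTensor_right (a b c : A) (h : H) (U : H ⊗[k] (H ⊗[k] H)) :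
    M.smashMul (a ⊗ₜ[k] h) (M.mulTensor b c U) =
      M.mulTensor₃ a b c (middleLeg H Q.comul (Q.reassocInv * (1 ⊗ₜ[k] Q.comul h)) *
        (1 ⊗ₜ[k] U)) := by
  induction U using tensor_induction₃ with
  | zero => simp
  | add x y hx hy => simp only [map_add, mul_add, TensorProduct.tmul_add, hx, hy]
  | tmul x y z =>
      have h0 : ((1 : H) ⊗ₜ[k] (Q.comul h * ((1 : H) ⊗ₜ[k] z)) : H ⊗[k] (H ⊗[k] H)) =
        (1 ⊗ₜ[k] Q.comul h) * (1 ⊗ₜ[k] (1 ⊗ₜ[k] z)) := by simp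
      rw [mulTensor_tmul, smashMul_tmul, mulTensor_act_right, h0, ← _root_.mul_assoc,
        map_mul _ _ ((1 : H) ⊗ₜ[k] ((1 : H) ⊗ₜ[k] z)),
        _root_.mul_assoc (middleLeg H Q.comul (Q.reassocInv * (1 ⊗ₜ[k] Q.comul h)))]
      congr 2
      simp [middleLeg, Algebra.TensorProduct.one_def]

lemma lastLeg_one_tmul (X : H ⊗[k] H) : lastLeg H Q.comul ((1 : H) ⊗ₜ[k] X) =
    (1 : H) ⊗ₜ[k] Algebra.TensorProduct.map (AlgHom.id k H) Q.comul X := by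
  simp [lastLeg]

lemma middleLeg_one_tmul (h : H) : middleLeg H Q.comul ((1 : H) ⊗ₜ[k] Q.comul h) =
    (1 : H) ⊗ₜ[k] iterLeft Q.comul h := by
  simp [middleLeg, iterLeft]

/-- The identity in `H ⊗ H ⊗ H ⊗ H` behind associativity and multiplicativity of the coaction. -/
lemma leg_identity (h : H) (X : H ⊗[k] H) :
    firstLeg Q.comul Q.reassocInv *
        lastLeg H Q.comul (Q.reassocInv * (1 ⊗ₜ[k] (Q.comul h * X))) =
      tensorOne k H H Q.reassocInv * (middleLeg H Q.comul (Q.reassocInv * (1 ⊗ₜ[k] Q.comul h)) *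
        (1 ⊗ₜ[k] (Q.reassocInv * Algebra.TensorProduct.map (AlgHom.id k H) Q.comul X))) := by
  have e1 : ((1 : H) ⊗ₜ[k] (iterRight Q.comul Q.comul h *
      Algebra.TensorProduct.map (AlgHom.id k H) Q.comul X) : H ⊗[k] (H ⊗[k] (H ⊗[k] H))) =
      (1 ⊗ₜ[k] iterRight Q.comul Q.comul h) *
        (1 ⊗ₜ[k] Algebra.TensorProduct.map (AlgHom.id k H) Q.comul X) := by simp
  have e2 : oneTensor k H H Q.reassocInv * ((1 : H) ⊗ₜ[k] iterRight Q.comul Q.comul h) =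
      ((1 : H) ⊗ₜ[k] iterLeft Q.comul h) * (1 ⊗ₜ[k] Q.reassocInv) := by
    rw [Algebra.TensorProduct.tmul_mul_tmul, Q.iterLeft_mul_inv, oneTensor,
      Algebra.TensorProduct.includeRight_apply, Algebra.TensorProduct.tmul_mul_tmul]
  have e3 : ((1 : H) ⊗ₜ[k] (Q.reassocInv *
      Algebra.TensorProduct.map (AlgHom.id k H) Q.comul X) : H ⊗[k] (H ⊗[k] (H ⊗[k] H))) =
      (1 ⊗ₜ[k] Q.reassocInv) *
        (1 ⊗ₜ[k] Algebra.TensorProduct.map (AlgHom.id k H) Q.comul X) := by simp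
  have e4 : lastLeg H Q.comul ((1 : H) ⊗ₜ[k] (Q.comul h * X)) =
      (1 : H) ⊗ₜ[k] (iterRight Q.comul Q.comul h *
      Algebra.TensorProduct.map (AlgHom.id k H) Q.comul X) := by
    rw [lastLeg_one_tmul, map_mul]; rfl
  rw [map_mul, e4, e1, e3, map_mul (middleLeg H Q.comul), middleLeg_one_tmul]
  have p := Q.pentagon_inv
  generalize firstLeg Q.comul Q.reassocInv = x1 at *
  generalize lastLeg H Q.comul Q.reassocInv = x2 at *
  generalize tensorOne k H H Q.reassocInv = x3 at *
  generalize middleLeg H Q.comul Q.reassocInv = x4 at *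
  generalize oneTensor k H H Q.reassocInv = x5 at *
  generalize ((1 : H) ⊗ₜ[k] iterRight Q.comul Q.comul h : H ⊗[k] (H ⊗[k] (H ⊗[k] H))) = x6 at *
  generalize ((1 : H) ⊗ₜ[k] iterLeft Q.comul h : H ⊗[k] (H ⊗[k] (H ⊗[k] H))) = x7 at *
  generalize ((1 : H) ⊗ₜ[k] Q.reassocInv : H ⊗[k] (H ⊗[k] (H ⊗[k] H))) = x8 at *
  rw [← _root_.mul_assoc, p, _root_.mul_assoc (x3 * x4), ← _root_.mul_assoc x5, e2]
  simp only [_root_.mul_assoc]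

lemma smashMul_assoc (x y z : A ⊗[k] H) :
    M.smashMul (M.smashMul x y) z = M.smashMul x (M.smashMul y z) := by
  induction x using TensorProduct.induction_on with
  | zero => simp
  | add x x' h h' => simp only [map_add, LinearMap.add_apply, h, h']
  | tmul a h =>
  induction y using TensorProduct.induction_on with
  | zero => simp
  | add x x' h h' => simp only [map_add, LinearMap.add_apply, h, h']
  | tmul b g =>
  induction z using TensorProduct.induction_on with
  | zero => simp
  | add x x' h h' => simp only [map_add, h, h']
  | tmul c f =>
    rw [smashMul_tmul, smashMul_tmul, smashMul_mulTensor_left, smashMul_mulTensor_right]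
    congr 1
    have e : tensorOne k H H Q.reassoc * tensorOne k H H Q.reassocInv = 1 := by
      rw [← map_mul, Q.reassoc_mul_inv, map_one]
    have l := leg_identity (Q := Q) h ((1 : H) ⊗ₜ[k] g)
    have e5 : ((1 : H) ⊗ₜ[k] (Q.reassocInv * Algebra.TensorProduct.map (AlgHom.id k H) Q.comul
        ((1 : H) ⊗ₜ[k] g)) * (1 ⊗ₜ[k] (1 ⊗ₜ[k] (1 ⊗ₜ[k] f))) : H ⊗[k] (H ⊗[k] (H ⊗[k] H))) =
        1 ⊗ₜ[k] (Q.reassocInv * (1 ⊗ₜ[k] (Q.comul g * (1 ⊗ₜ[k] f)))) := by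
      simp [_root_.mul_assoc]
    rw [_root_.mul_assoc (tensorOne k H H Q.reassoc),
      ← _root_.mul_assoc (firstLeg Q.comul Q.reassocInv), l, ← e5]
    generalize ((1 : H) ⊗ₜ[k] (Q.reassocInv * Algebra.TensorProduct.map (AlgHom.id k H) Q.comul
        ((1 : H) ⊗ₜ[k] g)) : H ⊗[k] (H ⊗[k] (H ⊗[k] H))) = x1
    generalize tensorOne k H H Q.reassocInv = x3 at *
    generalize tensorOne k H H Q.reassoc = x4 at *
    simp only [← _root_.mul_assoc]
    rw [e, _root_.one_mul]

lemma mulTensor_one_left (b : A) (Y : H ⊗[k] (H ⊗[k] H)) :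
    M.mulTensor M.one b Y = TensorProduct.map (M.orb b) LinearMap.id
      (Q.epsLeft (H ⊗[k] H) Y) := by
  refine tensor_ind₃ (M.mulTensor M.one b) (TensorProduct.map (M.orb b) LinearMap.id ∘ₗ
      (Q.epsLeft (H ⊗[k] H)).toLinearMap) ?_ Y
  intro x y z
  simp [M.act_one, M.one_mul, TensorProduct.smul_tmul']

lemma mulTensor_one_right (a : A) (Y : H ⊗[k] (H ⊗[k] H)) :
    M.mulTensor a M.one Y = TensorProduct.map (M.orb a) LinearMap.id
      (Algebra.TensorProduct.map (AlgHom.id k H) (Q.epsLeft H) Y) := by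
  refine tensor_ind₃ (M.mulTensor a M.one) (TensorProduct.map (M.orb a) LinearMap.id ∘ₗ
      (Algebra.TensorProduct.map (AlgHom.id k H) (Q.epsLeft H)).toLinearMap) ?_ Y
  intro x y z
  simp [M.act_one, M.mul_one, TensorProduct.smul_tmul']

/-- `(1 # h) (b # g) = (h₁ · b) # h₂ g` -/
lemma smashMul_one_left (h : H) (b : A) (g : H) :
    M.smashMul (M.one ⊗ₜ[k] h) (b ⊗ₜ[k] g) =
      TensorProduct.map (M.orb b) LinearMap.id (Q.comul h * (1 ⊗ₜ[k] g)) := by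
  rw [smashMul_tmul, mulTensor_one_left, map_mul, Q.epsLeft_reassocInv]
  simp

/-- `(a # h) (1 # g) = a # h g` -/
lemma smashMul_one_right (a : A) (h g : H) :
    M.smashMul (a ⊗ₜ[k] h) (M.one ⊗ₜ[k] g) = a ⊗ₜ[k] (h * g) := by
  rw [smashMul_tmul, mulTensor_one_right, map_mul, Q.epsMiddle_reassocInv]
  simp [Q.epsLeft_comul]

/-- The smash product `A # H`: the vector space `A ⊗ H`, with the algebra structure below. -/
def Smash (_M : ModuleAlgebra Q A) : Type _ := A ⊗[k] H

noncomputable instance : AddCommGroup M.Smash := inferInstanceAs (AddCommGroup (A ⊗[k] H))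

/-- The algebra `A # H`, with `(a # h) (b # g) = (x¹ · a) (x² h₁ · b) # x³ h₂ g` and
unit `1 # 1`. -/
noncomputable instance : Ring M.Smash where
  __ := (inferInstance : AddCommGroup M.Smash)
  mul := fun x y => M.smashMul x y
  one := (M.one ⊗ₜ[k] (1 : H) : A ⊗[k] H)
  left_distrib := fun x y z => map_add (M.smashMul x) y z
  right_distrib := fun x y z => LinearMap.map_add₂ M.smashMul x y z
  zero_mul := fun x => LinearMap.map_zero₂ M.smashMul x
  mul_zero := fun x => map_zero (M.smashMul x)
  mul_assoc := M.smashMul_assoc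
  one_mul := fun x => by
    change M.smashMul (M.one ⊗ₜ[k] (1 : H)) x = x
    induction x using TensorProduct.induction_on with
    | zero => simp
    | add x x' h h' => rw [map_add, h, h']
    | tmul a h =>
      rw [smashMul_one_left, map_one, _root_.one_mul]
      simp
  mul_one := fun x => by
    change M.smashMul x (M.one ⊗ₜ[k] (1 : H)) = x
    induction x using TensorProduct.induction_on with
    | zero => simp
    | add x x' h h' => rw [map_add, LinearMap.add_apply, h, h']
    | tmul a h => rw [smashMul_one_right, _root_.mul_one]

noncomputable instance : Algebra k M.Smash :=
  letI : Module k M.Smash := inferInstanceAs (Module k (A ⊗[k] H))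
  Algebra.ofModule (fun c x y => LinearMap.map_smul₂ M.smashMul c x y)
    (fun c x y => map_smul (M.smashMul x) c y)

/-- The identity map from `A ⊗ H` to `A # H`. -/
noncomputable def toSmash : A ⊗[k] H ≃ₗ[k] M.Smash where
  toFun := fun x => x
  invFun := fun x => x
  map_add' := fun _ _ => rfl
  map_smul' := fun _ _ => rfl
  left_inv := fun _ => rfl
  right_inv := fun _ => rfl

/-- The element `a # h` of the smash product. -/
noncomputable def smash (a : A) (h : H) : M.Smash := M.toSmash (a ⊗ₜ[k] h)

lemma toSmash_tmul (a : A) (h : H) : M.toSmash (a ⊗ₜ[k] h) = M.smash a h := rfl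

lemma toSmash_mul (x y : A ⊗[k] H) :
    M.toSmash x * M.toSmash y = M.toSmash (M.smashMul x y) := rfl

lemma smash_mul_smash (a b : A) (h g : H) : M.smash a h * M.smash b g =
    M.toSmash (M.mulTensor a b
      (Q.reassocInv * ((1 : H) ⊗ₜ[k] (Q.comul h * ((1 : H) ⊗ₜ[k] g))))) := rfl

lemma smash_one_one : M.smash M.one 1 = 1 := rfl

lemma smash_mul_one_smash (a : A) (h g : H) :
    M.smash a h * M.smash M.one g = M.smash a (h * g) :=
  congrArg M.toSmash (M.smashMul_one_right a h g)

/-- The algebra map `j : H → A # H`, `j h = 1 # h`. -/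
noncomputable def inclusion : H →ₐ[k] M.Smash :=
  AlgHom.ofLinearMap (M.toSmash.toLinearMap ∘ₗ TensorProduct.mk k A H M.one) rfl
    (fun g h => (M.smash_mul_one_smash M.one g h).symm)

@[simp] lemma inclusion_apply (h : H) : M.inclusion h = M.smash M.one h := rfl

lemma inclusion_mul (b : A) (h g : H) : M.smash M.one h * M.smash b g =
    M.toSmash (TensorProduct.map (M.orb b) LinearMap.id (Q.comul h * (1 ⊗ₜ[k] g))) :=
  congrArg M.toSmash (M.smashMul_one_left h b g)

/-- The map `w ↦ (w¹ · a # w²) ⊗ w³`. -/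
noncomputable def coactTensor (a : A) : H ⊗[k] (H ⊗[k] H) →ₗ[k] M.Smash ⊗[k] H :=
  (TensorProduct.map M.toSmash.toLinearMap LinearMap.id ∘ₗ
    (TensorProduct.assoc k A H H).symm.toLinearMap) ∘ₗ
    TensorProduct.map (M.orb a) LinearMap.id

@[simp] lemma coactTensor_tmul (a : A) (x y z : H) :
    M.coactTensor a (x ⊗ₜ[k] (y ⊗ₜ[k] z)) = M.smash (M.act x a) y ⊗ₜ[k] z := rfl

/-- The linear map `a # h ↦ (x¹ · a # x² h₁) ⊗ x³ h₂`, where `Φ⁻¹ = x¹ ⊗ x² ⊗ x³`. -/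
noncomputable def smashCoactLinear : A ⊗[k] H →ₗ[k] M.Smash ⊗[k] H :=
  TensorProduct.lift (LinearMap.mk₂ k
    (fun a h => M.coactTensor a (Q.reassocInv * ((1 : H) ⊗ₜ[k] Q.comul h)))
    (fun a b h => by simp [coactTensor, TensorProduct.map_add_left])
    (fun c a h => by simp [coactTensor, TensorProduct.map_smul_left])
    (fun a h g => by simp [TensorProduct.tmul_add, mul_add])
    (fun c a h => by simp))

@[simp] lemma smashCoactLinear_tmul (a : A) (h : H) : M.smashCoactLinear (a ⊗ₜ[k] h) =
    M.coactTensor a (Q.reassocInv * ((1 : H) ⊗ₜ[k] Q.comul h)) := rfl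

/-- The map `w ↦ ((w¹ · a) (w² · b) # w³) ⊗ w⁴`. -/
noncomputable def coactTensor₂ (a b : A) :
    H ⊗[k] (H ⊗[k] (H ⊗[k] H)) →ₗ[k] M.Smash ⊗[k] H :=
  (TensorProduct.map M.toSmash.toLinearMap LinearMap.id ∘ₗ
    (TensorProduct.assoc k A H H).symm.toLinearMap) ∘ₗ
    (TensorProduct.map (TensorProduct.lift M.mul) LinearMap.id ∘ₗ
    (TensorProduct.assoc k A A (H ⊗[k] H)).symm.toLinearMap) ∘ₗ
    TensorProduct.map (M.orb a) (TensorProduct.map (M.orb b) LinearMap.id)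

@[simp] lemma coactTensor₂_tmul (a b : A) (x y z t : H) :
    M.coactTensor₂ a b (x ⊗ₜ[k] (y ⊗ₜ[k] (z ⊗ₜ[k] t))) =
      M.smash (M.mul (M.act x a) (M.act y b)) z ⊗ₜ[k] t := rfl

lemma coactTensor_act (a b : A) (u v : H) (Y : H ⊗[k] (H ⊗[k] H)) :
    M.coactTensor (M.mul (M.act u a) (M.act v b)) Y =
      M.coactTensor₂ a b (firstLeg Q.comul Y * (u ⊗ₜ[k] (v ⊗ₜ[k] 1))) := by
  induction Y using tensor_induction₃ with
  | zero => simp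
  | add x y hx hy => simp only [map_add, add_mul, hx, hy]
  | tmul x y z =>
      rw [coactTensor_tmul, M.act_mul]
      simp only [firstLeg, AlgHom.comp_apply, Algebra.TensorProduct.map_tmul]
      generalize Q.comul x = D
      simp only [smash]
      induction D using TensorProduct.induction_on with
      | zero => simp
      | add D D' h h' =>
        simp only [map_add, TensorProduct.add_tmul, h, h', add_mul]
      | tmul d e =>
        simp [Algebra.TensorProduct.one_def, smash]

lemma smashCoactLinear_mulTensor (a b : A) (W : H ⊗[k] (H ⊗[k] H)) :
    M.smashCoactLinear (M.mulTensor a b W) =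
      M.coactTensor₂ a b (firstLeg Q.comul Q.reassocInv * lastLeg H Q.comul W) := by
  induction W using tensor_induction₃ with
  | zero => simp
  | add x y hx hy => simp only [map_add, mul_add, hx, hy]
  | tmul x y z =>
      rw [mulTensor_tmul, smashCoactLinear_tmul, coactTensor_act, map_mul (firstLeg Q.comul),
        _root_.mul_assoc (firstLeg Q.comul Q.reassocInv)]
      congr 2
      have h1 : ∀ X : H ⊗[k] H, firstLeg Q.comul ((1 : H) ⊗ₜ[k] X) = 1 ⊗ₜ[k] (1 ⊗ₜ[k] X) := by
        intro X
        simp [firstLeg, Algebra.TensorProduct.one_def]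
      simp [h1, lastLeg]

lemma coactTensor_mul (a b : A) (P P' : H ⊗[k] (H ⊗[k] H)) :
    M.coactTensor a P * M.coactTensor b P' =
      M.coactTensor₂ a b (tensorOne k H H Q.reassocInv *
        (middleLeg H Q.comul P * (1 ⊗ₜ[k] P'))) := by
  induction P using tensor_induction₃ with
  | zero => simp
  | add x y hx hy => simp only [map_add, mul_add, add_mul, hx, hy]
  | tmul x y z =>
  induction P' using tensor_induction₃ with
  | zero => simp
  | add x y hx hy => simp only [map_add, mul_add, TensorProduct.tmul_add, hx, hy]
  | tmul x' y' z' =>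
    rw [coactTensor_tmul, coactTensor_tmul, Algebra.TensorProduct.tmul_mul_tmul, smash_mul_smash]
    simp only [middleLeg, Algebra.TensorProduct.map_tmul, AlgHom.comp_apply]
    generalize Q.reassocInv = w
    generalize Q.comul y = D
    induction D using TensorProduct.induction_on with
    | zero => simp
    | add x y hx hy =>
      simp only [map_add, mul_add, add_mul, TensorProduct.tmul_add, TensorProduct.add_tmul, hx, hy]
    | tmul d e =>
    induction w using tensor_induction₃ with
    | zero => simp
    | add x y hx hy => simp only [map_add, add_mul, TensorProduct.add_tmul, hx, hy]
    | tmul p q r =>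
      simp [tensorOne, toSmash_tmul]

lemma coactTensor_one (Y : H ⊗[k] (H ⊗[k] H)) :
    M.coactTensor M.one Y = Algebra.TensorProduct.map M.inclusion (AlgHom.id k H)
      (Q.epsLeft (H ⊗[k] H) Y) := by
  refine tensor_ind₃ (M.coactTensor M.one)
    ((Algebra.TensorProduct.map M.inclusion (AlgHom.id k H)).toLinearMap ∘ₗ
      (Q.epsLeft (H ⊗[k] H)).toLinearMap) ?_ Y
  intro x y z
  simp only [AlgHom.toLinearMap_apply, LinearMap.comp_apply, coactTensor_tmul, M.act_one, smash,
    ← TensorProduct.smul_tmul', map_smul, QuasiBialgebra.epsLeft_tmul,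
    Algebra.TensorProduct.map_tmul, inclusion_apply, AlgHom.coe_id, id_eq]

lemma smashCoactLinear_one (h : H) : M.smashCoactLinear (M.one ⊗ₜ[k] h) =
    Algebra.TensorProduct.map M.inclusion (AlgHom.id k H) (Q.comul h) := by
  rw [smashCoactLinear_tmul, coactTensor_one, map_mul, Q.epsLeft_reassocInv, _root_.one_mul]
  simp

lemma smashCoactLinear_mul (x y : A ⊗[k] H) : M.smashCoactLinear (M.smashMul x y) =
    M.smashCoactLinear x * M.smashCoactLinear y := by
  induction x using TensorProduct.induction_on with
  | zero => simp
  | add x x' h h' => simp only [map_add, LinearMap.add_apply, add_mul, h, h']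
  | tmul a h =>
  induction y using TensorProduct.induction_on with
  | zero => simp
  | add x x' h h' => simp only [map_add, mul_add, h, h']
  | tmul b g =>
    rw [smashMul_tmul, smashCoactLinear_mulTensor, smashCoactLinear_tmul,
      smashCoactLinear_tmul, coactTensor_mul, leg_identity]
    simp

/-- The coaction `ρ (a # h) = (x¹ · a # x² h₁) ⊗ x³ h₂` of the smash product. -/
noncomputable def smashCoact : M.Smash →ₐ[k] M.Smash ⊗[k] H :=
  AlgHom.ofLinearMap (M.smashCoactLinear ∘ₗ M.toSmash.symm.toLinearMap)
    (by
      change M.smashCoactLinear (M.one ⊗ₜ[k] (1 : H)) = 1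
      rw [smashCoactLinear_one, map_one, map_one])
    M.smashCoactLinear_mul

lemma smashCoact_smash (a : A) (h : H) : M.smashCoact (M.smash a h) =
    M.coactTensor a (Q.reassocInv * ((1 : H) ⊗ₜ[k] Q.comul h)) := rfl

lemma smashCoact_inclusion (h : H) : M.smashCoact (M.inclusion h) =
    Algebra.TensorProduct.map M.inclusion (AlgHom.id k H) (Q.comul h) :=
  M.smashCoactLinear_one h

/-- The map `w ↦ (w¹ · a # w²) ⊗ w³ ⊗ w⁴`. -/
noncomputable def coactTensor₃ (a : A) :
    H ⊗[k] (H ⊗[k] (H ⊗[k] H)) →ₗ[k] M.Smash ⊗[k] (H ⊗[k] H) :=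
  (TensorProduct.map M.toSmash.toLinearMap LinearMap.id ∘ₗ
    (TensorProduct.assoc k A H (H ⊗[k] H)).symm.toLinearMap) ∘ₗ
    TensorProduct.map (M.orb a) LinearMap.id

@[simp] lemma coactTensor₃_tmul (a : A) (x y z t : H) :
    M.coactTensor₃ a (x ⊗ₜ[k] (y ⊗ₜ[k] (z ⊗ₜ[k] t))) =
      M.smash (M.act x a) y ⊗ₜ[k] (z ⊗ₜ[k] t) := rfl

lemma map_smashCoact_coactTensor (a : A) (P : H ⊗[k] (H ⊗[k] H)) :
    Algebra.TensorProduct.assoc k k k M.Smash H H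
      (Algebra.TensorProduct.map M.smashCoact (AlgHom.id k H) (M.coactTensor a P)) =
      M.coactTensor₃ a (tensorOne k H H Q.reassocInv * middleLeg H Q.comul P) := by
  induction P using tensor_induction₃ with
  | zero => simp
  | add x y hx hy => simp only [map_add, mul_add, hx, hy]
  | tmul x y z =>
    rw [coactTensor_tmul, Algebra.TensorProduct.map_tmul, smashCoact_smash]
    simp only [middleLeg, Algebra.TensorProduct.map_tmul, AlgHom.comp_apply]
    generalize Q.reassocInv = w
    generalize Q.comul y = D
    induction D using TensorProduct.induction_on with
    | zero => simp
    | add x y hx hy =>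
      simp only [map_add, mul_add, TensorProduct.tmul_add, TensorProduct.add_tmul, hx, hy]
    | tmul d e =>
    induction w using tensor_induction₃ with
    | zero => simp
    | add x y hx hy => simp only [map_add, add_mul, TensorProduct.add_tmul, hx, hy]
    | tmul p q r => simp [tensorOne]

lemma map_comul_coactTensor (a : A) (P : H ⊗[k] (H ⊗[k] H)) :
    Algebra.TensorProduct.map (AlgHom.id k M.Smash) Q.comul (M.coactTensor a P) =
      M.coactTensor₃ a (lastLeg H Q.comul P) := by
  induction P using tensor_induction₃ with
  | zero => simp
  | add x y hx hy => simp only [map_add, hx, hy]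
  | tmul x y z => rfl

lemma map_inclusion_mul_coactTensor₃ (a : A) (X : H ⊗[k] (H ⊗[k] H))
    (V : H ⊗[k] (H ⊗[k] (H ⊗[k] H))) :
    Algebra.TensorProduct.map M.inclusion (AlgHom.id k (H ⊗[k] H)) X * M.coactTensor₃ a V =
      M.coactTensor₃ a (firstLeg Q.comul X * V) := by
  induction X using TensorProduct.induction_on with
  | zero => simp
  | add x y hx hy => simp only [map_add, add_mul, hx, hy]
  | tmul x w =>
  induction V using tensor_induction₃ with
  | zero => simp
  | add x y hx hy => simp only [map_add, mul_add, hx, hy]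
  | tmul u v y =>
  induction y using TensorProduct.induction_on with
  | zero => simp
  | add x y hx hy => simp only [TensorProduct.tmul_add, map_add, mul_add, hx, hy]
  | tmul s t =>
  induction w using TensorProduct.induction_on with
  | zero => simp
  | add x y hx hy => simp only [TensorProduct.tmul_add, map_add, add_mul, hx, hy]
  | tmul y z =>
    rw [coactTensor₃_tmul, Algebra.TensorProduct.map_tmul, inclusion_apply,
      Algebra.TensorProduct.tmul_mul_tmul, inclusion_mul]
    simp only [firstLeg, Algebra.TensorProduct.map_tmul, AlgHom.comp_apply]
    generalize Q.comul x = D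
    induction D using TensorProduct.induction_on with
    | zero => simp
    | add x y hx hy => simp only [map_add, add_mul, TensorProduct.add_tmul, hx, hy]
    | tmul d e => simp [toSmash_tmul]

lemma coactTensor₃_mul_map_inclusion (a : A) (X : H ⊗[k] (H ⊗[k] H))
    (V : H ⊗[k] (H ⊗[k] (H ⊗[k] H))) :
    M.coactTensor₃ a V * Algebra.TensorProduct.map M.inclusion (AlgHom.id k (H ⊗[k] H)) X =
      M.coactTensor₃ a (V * oneTensor k H H X) := by
  induction X using TensorProduct.induction_on with
  | zero => simp
  | add x y hx hy => simp only [map_add, mul_add, hx, hy]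
  | tmul x w =>
  induction V using tensor_induction₃ with
  | zero => simp
  | add x y hx hy => simp only [map_add, add_mul, hx, hy]
  | tmul u v y =>
  induction y using TensorProduct.induction_on with
  | zero => simp
  | add x y hx hy => simp only [TensorProduct.tmul_add, map_add, add_mul, hx, hy]
  | tmul s t =>
  induction w using TensorProduct.induction_on with
  | zero => simp
  | add x y hx hy => simp only [TensorProduct.tmul_add, map_add, mul_add, hx, hy]
  | tmul y z => simp [smash_mul_one_smash, oneTensor]

lemma leg_identity' (h : H) :
    firstLeg Q.comul Q.reassoc * (tensorOne k H H Q.reassocInv *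
        middleLeg H Q.comul (Q.reassocInv * (1 ⊗ₜ[k] Q.comul h))) =
      lastLeg H Q.comul (Q.reassocInv * (1 ⊗ₜ[k] Q.comul h)) * oneTensor k H H Q.reassoc := by
  have e1 : oneTensor k H H Q.reassoc * ((1 : H) ⊗ₜ[k] iterLeft Q.comul h) =
      ((1 : H) ⊗ₜ[k] iterRight Q.comul Q.comul h) * oneTensor k H H Q.reassoc := by
    rw [oneTensor, Algebra.TensorProduct.includeRight_apply, Algebra.TensorProduct.tmul_mul_tmul,
      Q.quasi_coassoc', Algebra.TensorProduct.tmul_mul_tmul]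
  have e2 : lastLeg H Q.comul ((1 : H) ⊗ₜ[k] Q.comul h) =
      (1 : H) ⊗ₜ[k] iterRight Q.comul Q.comul h := lastLeg_one_tmul _
  have i1 : lastLeg H Q.comul Q.reassocInv * lastLeg H Q.comul Q.reassoc = 1 := by
    rw [← map_mul, Q.reassocInv_mul, map_one]
  have i2 : tensorOne k H H Q.reassoc * tensorOne k H H Q.reassocInv = 1 := by
    rw [← map_mul, Q.reassoc_mul_inv, map_one]
  have i3 : middleLeg H Q.comul Q.reassoc * middleLeg H Q.comul Q.reassocInv = 1 := by
    rw [← map_mul, Q.reassoc_mul_inv, map_one]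
  rw [map_mul (middleLeg H Q.comul), map_mul (lastLeg H Q.comul), e2, middleLeg_one_tmul]
  have p := Q.pentagon
  generalize firstLeg Q.comul (Q.reassoc : H ⊗[k] (H ⊗[k] H)) = x1 at *
  generalize lastLeg H Q.comul (Q.reassoc : H ⊗[k] (H ⊗[k] H)) = x2 at *
  generalize lastLeg H Q.comul Q.reassocInv = y2 at *
  generalize tensorOne k H H (Q.reassoc : H ⊗[k] (H ⊗[k] H)) = x3 at *
  generalize tensorOne k H H Q.reassocInv = y3 at *
  generalize middleLeg H Q.comul (Q.reassoc : H ⊗[k] (H ⊗[k] H)) = x4 at *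
  generalize middleLeg H Q.comul Q.reassocInv = y4 at *
  generalize oneTensor k H H (Q.reassoc : H ⊗[k] (H ⊗[k] H)) = x5 at *
  generalize ((1 : H) ⊗ₜ[k] iterRight Q.comul Q.comul h : H ⊗[k] (H ⊗[k] (H ⊗[k] H))) = x6 at *
  generalize ((1 : H) ⊗ₜ[k] iterLeft Q.comul h : H ⊗[k] (H ⊗[k] (H ⊗[k] H))) = x7 at *
  have q : x1 = y2 * (x5 * x4 * x3) := by
    rw [p, ← _root_.mul_assoc, i1, _root_.one_mul]
  rw [q]
  calc y2 * (x5 * x4 * x3) * (y3 * (y4 * x7)) = y2 * x5 * (x4 * (x3 * y3) * y4) * x7 := by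
        simp only [_root_.mul_assoc]
    _ = y2 * (x5 * x7) := by
        rw [i2, _root_.mul_one, i3, _root_.mul_one, _root_.mul_assoc]
    _ = y2 * x6 * x5 := by rw [e1, _root_.mul_assoc]

lemma smashCoact_quasi_coassoc (x : M.Smash) :
    Algebra.TensorProduct.map M.inclusion (AlgHom.id k (H ⊗[k] H)) Q.reassoc *
      iterLeft M.smashCoact x = iterRight Q.comul M.smashCoact x *
        Algebra.TensorProduct.map M.inclusion (AlgHom.id k (H ⊗[k] H)) Q.reassoc := by
  obtain ⟨y, rfl⟩ := M.toSmash.surjective x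
  induction y using TensorProduct.induction_on with
  | zero => simp
  | add x y hx hy => simp only [map_add, mul_add, add_mul, hx, hy]
  | tmul a h =>
    have e1 : iterLeft M.smashCoact (M.smash a h) = Algebra.TensorProduct.assoc k k k M.Smash H H
      (Algebra.TensorProduct.map M.smashCoact (AlgHom.id k H) (M.smashCoact (M.smash a h))) := rfl
    have e2 : iterRight Q.comul M.smashCoact (M.smash a h) = Algebra.TensorProduct.map
      (AlgHom.id k M.Smash) Q.comul (M.smashCoact (M.smash a h)) := rfl
    rw [toSmash_tmul, e1, e2, smashCoact_smash, map_smashCoact_coactTensor,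
      map_comul_coactTensor, map_inclusion_mul_coactTensor₃, coactTensor₃_mul_map_inclusion,
      leg_identity']

lemma smashCoact_id_counit (x : M.Smash) :
    Algebra.TensorProduct.map (AlgHom.id k M.Smash) Q.counit (M.smashCoact x) =
      x ⊗ₜ[k] (1 : k) := by
  obtain ⟨y, rfl⟩ := M.toSmash.surjective x
  induction y using TensorProduct.induction_on with
  | zero => simp
  | add x y hx hy => simp only [map_add, TensorProduct.add_tmul, hx, hy]
  | tmul a h =>
    have e : ∀ Y, Algebra.TensorProduct.map (AlgHom.id k M.Smash) Q.counit (M.coactTensor a Y) =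
        M.toSmash (TensorProduct.map (M.orb a) LinearMap.id
          (Algebra.TensorProduct.map (AlgHom.id k H) (Q.epsRight H) Y)) ⊗ₜ[k] (1 : k) := by
      refine tensor_ind₃ ((Algebra.TensorProduct.map (AlgHom.id k M.Smash)
        Q.counit).toLinearMap ∘ₗ M.coactTensor a)
        ((TensorProduct.mk k M.Smash k).flip 1 ∘ₗ M.toSmash.toLinearMap ∘ₗ
          TensorProduct.map (M.orb a) LinearMap.id ∘ₗ
          (Algebra.TensorProduct.map (AlgHom.id k H) (Q.epsRight H)).toLinearMap) ?_
      intro x y z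
      have hz : ∀ u : M.Smash, u ⊗ₜ[k] Q.counit z = (Q.counit z • u) ⊗ₜ[k] (1 : k) := by
        intro u
        rw [TensorProduct.smul_tmul, smul_eq_mul, _root_.mul_one]
      simp [hz, smash]
      rw [← TensorProduct.smul_tmul']
    rw [toSmash_tmul, smashCoact_smash, e, map_mul, Q.epsRight_reassocInv, _root_.one_mul]
    simp [Q.epsRight_comul, smash]

/-- The smash product `A # H` as a right `H`-comodule algebra, with
`ρ (a # h) = (x¹ · a # x² h₁) ⊗ x³ h₂` and `Φ_ρ = (1 # X¹) ⊗ X² ⊗ X³`. -/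
noncomputable def smashComodule : ComoduleAlgebra Q M.Smash where
  coact := M.smashCoact
  reassoc := Units.map (Algebra.TensorProduct.map M.inclusion
    (AlgHom.id k (H ⊗[k] H))).toMonoidHom Q.reassoc
  quasi_coassoc := M.smashCoact_quasi_coassoc
  pentagon := by
    let f := Algebra.TensorProduct.map M.inclusion (AlgHom.id k (H ⊗[k] H))
    let F := Algebra.TensorProduct.map M.inclusion (AlgHom.id k (H ⊗[k] (H ⊗[k] H)))
    have h1 : ∀ x, oneTensor k H M.Smash x = F (oneTensor k H H x) := by
      intro x
      simp only [F, oneTensor, Algebra.TensorProduct.includeRight_apply,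
        Algebra.TensorProduct.map_tmul, map_one, AlgHom.coe_id, id_eq]
    have h2 : ∀ x, middleLeg M.Smash Q.comul (f x) = F (middleLeg H Q.comul x) := by
      intro x
      induction x using TensorProduct.induction_on with
      | zero => simp
      | add x y hx hy => simp only [map_add, hx, hy]
      | tmul x y => rfl
    have h3 : ∀ x, tensorOne k H M.Smash (f x) = F (tensorOne k H H x) := by
      refine tensor_ind₃ ((tensorOne k H M.Smash).toLinearMap ∘ₗ f.toLinearMap)
        (F.toLinearMap ∘ₗ (tensorOne k H H).toLinearMap) ?_
      intro x y z
      rfl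
    have h4 : ∀ x, lastLeg M.Smash Q.comul (f x) = F (lastLeg H Q.comul x) := by
      intro x
      induction x using TensorProduct.induction_on with
      | zero => simp
      | add x y hx hy => simp only [map_add, hx, hy]
      | tmul x y => rfl
    have h5 : ∀ x, firstLeg M.smashCoact (f x) = F (firstLeg Q.comul x) := by
      intro x
      induction x using TensorProduct.induction_on with
      | zero => simp
      | add x y hx hy => simp only [map_add, hx, hy]
      | tmul x y =>
        simp only [firstLeg, AlgHom.comp_apply, f, F, Algebra.TensorProduct.map_tmul,
          smashCoact_inclusion]
        generalize Q.comul x = D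
        induction D using TensorProduct.induction_on with
        | zero => simp
        | add x y hx hy => simp only [map_add, TensorProduct.add_tmul, hx, hy]
        | tmul d e => rfl
    change oneTensor k H M.Smash Q.reassoc * middleLeg M.Smash Q.comul (f Q.reassoc) *
      tensorOne k H M.Smash (f Q.reassoc) =
      lastLeg M.Smash Q.comul (f Q.reassoc) * firstLeg M.smashCoact (f Q.reassoc)
    rw [h1, h2, h3, h4, h5, ← map_mul F, ← map_mul F, ← map_mul F, Q.pentagon]
  id_counit := M.smashCoact_id_counit
  id_counit_id := by
    have h : ∀ x : H ⊗[k] (H ⊗[k] H), Algebra.TensorProduct.map (AlgHom.id k M.Smash)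
        (Algebra.TensorProduct.map Q.counit (AlgHom.id k H))
        (Algebra.TensorProduct.map M.inclusion (AlgHom.id k (H ⊗[k] H)) x) =
        Algebra.TensorProduct.map M.inclusion (AlgHom.id k (k ⊗[k] H))
        (Algebra.TensorProduct.map (AlgHom.id k H)
          (Algebra.TensorProduct.map Q.counit (AlgHom.id k H)) x) := by
      intro x
      induction x using TensorProduct.induction_on with
      | zero => simp
      | add x y hx hy => simp only [map_add, hx, hy]
      | tmul x y => rfl
    refine (h _).trans ?_
    rw [Q.id_counit_id, map_one]
  id_id_counit := by
    have h : ∀ x : H ⊗[k] (H ⊗[k] H), Algebra.TensorProduct.map (AlgHom.id k M.Smash)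
        (Algebra.TensorProduct.map (AlgHom.id k H) Q.counit)
        (Algebra.TensorProduct.map M.inclusion (AlgHom.id k (H ⊗[k] H)) x) =
        Algebra.TensorProduct.map M.inclusion (AlgHom.id k (H ⊗[k] k))
        (Algebra.TensorProduct.map (AlgHom.id k H)
          (Algebra.TensorProduct.map (AlgHom.id k H) Q.counit) x) := by
      intro x
      induction x using TensorProduct.induction_on with
      | zero => simp
      | add x y hx hy => simp only [map_add, hx, hy]
      | tmul x y => rfl
    refine (h _).trans ?_
    rw [Q.id_id_counit, map_one]

end ModuleAlgebra

end SmashProducts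

namespace QuasiHopfAlgebra

variable {k H B : Type*} [Field k] [Ring H] [Algebra k H] [Ring B] [Algebra k B]
  (Q : QuasiHopfAlgebra k H)

/-- The element `q_R = q¹ ⊗ q² = X¹ ⊗ S⁻¹(α X³) X²`, where `Φ = X¹ ⊗ X² ⊗ X³`. -/
noncomputable def qR : H ⊗[k] H :=
  TensorProduct.map LinearMap.id
    (LinearMap.mul' k H ∘ₗ TensorProduct.map
      (Q.antipode.symm.toLinearMap ∘ₗ LinearMap.mulLeft k Q.alpha) LinearMap.id ∘ₗ
      (TensorProduct.comm k H H).toLinearMap)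
    (Q.reassoc : H ⊗[k] (H ⊗[k] H))

/-- The map `E(b) = v(q¹) b₀ v(β S(q² b₁))`, where `ρ(b) = b₀ ⊗ b₁` and `q_R = q¹ ⊗ q²`. -/
noncomputable def proj (C : ComoduleAlgebra Q.toQuasiBialgebra B) (v : H →ₐ[k] B) :
    B →ₗ[k] B :=
  LinearMap.mul' k B ∘ₗ
    TensorProduct.map LinearMap.id
      (v.toLinearMap ∘ₗ LinearMap.mulLeft k Q.beta ∘ₗ Q.antipode.toLinearMap) ∘ₗ
    LinearMap.mulLeft k (TensorProduct.map v.toLinearMap LinearMap.id Q.qR) ∘ₗ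
    C.coact.toLinearMap

/-- The coinvariants `B^{co(H)} = E(B)`. -/
noncomputable def coinvariants (C : ComoduleAlgebra Q.toQuasiBialgebra B) (v : H →ₐ[k] B) :
    Submodule k B :=
  LinearMap.range (Q.proj C v)

end QuasiHopfAlgebra

end QuasiHopf

namespace QuasiHopf

namespace QuasiHopfAlgebra

set_option maxSynthPendingDepth 10

variable {k H B : Type*} [Field k] [Ring H] [Algebra k H] [Ring B] [Algebra k B]
  (Q : QuasiHopfAlgebra k H)

/-- The linear map `x ⊗ y ↦ β S(x) α y`. -/
noncomputable def betaAlpha : H ⊗[k] H →ₗ[k] H :=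
  LinearMap.mul' k H ∘ₗ TensorProduct.map
    (LinearMap.mulLeft k Q.beta ∘ₗ LinearMap.mulRight k Q.alpha ∘ₗ Q.antipode.toLinearMap)
    LinearMap.id

@[simp] lemma betaAlpha_tmul (x y : H) :
    Q.betaAlpha (x ⊗ₜ[k] y) = Q.beta * (Q.antipode x * Q.alpha) * y := rfl

lemma betaAlpha_comul_mul (h : H) (w : H ⊗[k] H) :
    Q.betaAlpha (Q.comul h * w) = Q.counit h • Q.betaAlpha w := by
  induction w using TensorProduct.induction_on with
  | zero => simp
  | add x y hx hy => simp only [mul_add, map_add, hx, hy, smul_add]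
  | tmul x y =>
    have e : ∀ D : H ⊗[k] H, Q.betaAlpha (D * (x ⊗ₜ[k] y)) =
        Q.beta * Q.antipode x * LinearMap.mul' k H (TensorProduct.map
          (LinearMap.mulRight k Q.alpha ∘ₗ Q.antipode.toLinearMap) LinearMap.id D) * y := by
      intro D
      induction D using TensorProduct.induction_on with
      | zero => simp
      | add D D' h h' => simp only [mul_add, add_mul, map_add, h, h']
      | tmul d e => simp [Q.antipode_mul, mul_assoc]
    rw [e, Q.antipode_alpha]
    simp [mul_assoc]

/-- The linear map `x ⊗ y ⊗ z ↦ x β S(y) α z`. -/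
noncomputable def mulBetaAlpha : H ⊗[k] (H ⊗[k] H) →ₗ[k] H :=
  LinearMap.mul' k H ∘ₗ TensorProduct.map LinearMap.id Q.betaAlpha

@[simp] lemma mulBetaAlpha_tmul (x : H) (w : H ⊗[k] H) :
    Q.mulBetaAlpha (x ⊗ₜ[k] w) = x * Q.betaAlpha w := rfl

lemma mulBetaAlpha_reassoc : Q.mulBetaAlpha Q.reassoc = 1 := by
  refine Eq.trans ?_ Q.reassoc_antipode
  refine tensor_ind₃ Q.mulBetaAlpha (LinearMap.mul' k H ∘ₗ TensorProduct.map
    (LinearMap.mulRight k Q.beta) (LinearMap.mul' k H ∘ₗ TensorProduct.map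
      (LinearMap.mulRight k Q.alpha ∘ₗ Q.antipode.toLinearMap) LinearMap.id)) ?_ _
  intro x y z
  simp [mul_assoc]

lemma mulBetaAlpha_mul_comul (w : H ⊗[k] (H ⊗[k] H)) (h y : H) :
    Q.mulBetaAlpha (w * Algebra.TensorProduct.assoc k k k H H H (Q.comul h ⊗ₜ[k] y)) =
      Q.counit h • (Q.mulBetaAlpha w * y) := by
  induction w using tensor_induction₃ with
  | zero => simp
  | add u v hu hv => simp only [map_add, add_mul, hu, hv, smul_add]
  | tmul a b c =>
    have e : ∀ D : H ⊗[k] H, Q.mulBetaAlpha (a ⊗ₜ[k] (b ⊗ₜ[k] c) *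
        Algebra.TensorProduct.assoc k k k H H H (D ⊗ₜ[k] y)) =
        a * LinearMap.mul' k H (TensorProduct.map
          (LinearMap.mulRight k Q.beta) Q.antipode.toLinearMap D) *
          (Q.antipode b * Q.alpha * c * y) := by
      intro D
      induction D using TensorProduct.induction_on with
      | zero => simp
      | add D D' h h' => simp only [mul_add, add_mul, map_add, TensorProduct.add_tmul, h, h']
      | tmul d e => simp [Q.antipode_mul, mul_assoc]
    rw [e, Q.beta_antipode]
    simp [mul_assoc]

variable (v : H →ₐ[k] B)

/-- The linear map `b ⊗ x ⊗ y ↦ b v(β S(x) α y)`. -/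
noncomputable def contract : B ⊗[k] (H ⊗[k] H) →ₗ[k] B :=
  LinearMap.mul' k B ∘ₗ TensorProduct.map LinearMap.id (v.toLinearMap ∘ₗ Q.betaAlpha)

@[simp] lemma contract_tmul (b : B) (w : H ⊗[k] H) :
    Q.contract v (b ⊗ₜ[k] w) = b * v (Q.betaAlpha w) := rfl

lemma contract_map_comul_mul (d : B ⊗[k] H) (w : B ⊗[k] (H ⊗[k] H)) :
    Q.contract v (Algebra.TensorProduct.map (AlgHom.id k B) Q.comul d * w) =
      Q.epsRight B d * Q.contract v w := by
  induction d using TensorProduct.induction_on with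
  | zero => simp
  | add d e hd he => simp only [map_add, add_mul, hd, he]
  | tmul b h =>
  induction w using TensorProduct.induction_on with
  | zero => simp
  | add d e hd he => simp only [map_add, mul_add, hd, he]
  | tmul c w => simp [betaAlpha_comul_mul, mul_assoc]

lemma contract_mul_includeLeft (w : B ⊗[k] (H ⊗[k] H)) (h : H) :
    Q.contract v (w * Algebra.TensorProduct.map (AlgHom.id k B)
      Algebra.TensorProduct.includeLeft
      (Algebra.TensorProduct.map v (AlgHom.id k H) (Q.comul h))) =
      Q.counit h • Q.contract v w := by
  induction w using tensor_induction₃ with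
  | zero => simp
  | add u v hu hv => simp only [map_add, add_mul, hu, hv, smul_add]
  | tmul b x y =>
    have e : ∀ D : H ⊗[k] H, Q.contract v (b ⊗ₜ[k] (x ⊗ₜ[k] y) *
        Algebra.TensorProduct.map (AlgHom.id k B) Algebra.TensorProduct.includeLeft
          (Algebra.TensorProduct.map v (AlgHom.id k H) D)) =
        b * v (LinearMap.mul' k H (TensorProduct.map
          (LinearMap.mulRight k Q.beta) Q.antipode.toLinearMap D) *
          (Q.antipode x * Q.alpha * y)) := by
      intro D
      induction D using TensorProduct.induction_on with
      | zero => simp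
      | add D D' h h' => simp only [mul_add, add_mul, map_add, h, h']
      | tmul d e => simp [Q.antipode_mul, mul_assoc]
    rw [e, Q.beta_antipode]
    simp [mul_assoc]

variable {v} {C : ComoduleAlgebra Q.toQuasiBialgebra B}

lemma coact_map (hv : IsComoduleAlgebraHom Q.toQuasiBialgebra.regular C v) (h : H) :
    C.coact (v h) = Algebra.TensorProduct.map v (AlgHom.id k H) (Q.comul h) :=
  hv.map_coact h

lemma reassoc_eq (hv : IsComoduleAlgebraHom Q.toQuasiBialgebra.regular C v) :
    (C.reassoc : B ⊗[k] (H ⊗[k] H)) =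
      Algebra.TensorProduct.map v (AlgHom.id k (H ⊗[k] H)) (Q.reassoc : H ⊗[k] (H ⊗[k] H)) :=
  hv.map_reassoc

lemma epsRight_coact (b : B) : Q.epsRight B (C.coact b) = b := by
  have := congrArg (Algebra.TensorProduct.rid k k B) (C.id_counit b)
  simpa [QuasiBialgebra.epsRight] using this

lemma iterLeft_coact (C : ComoduleAlgebra Q.toQuasiBialgebra B) (b : B) :
    iterLeft C.coact b = ((C.reassoc⁻¹ : (B ⊗[k] (H ⊗[k] H))ˣ) : B ⊗[k] (H ⊗[k] H)) *
      (iterRight Q.comul C.coact b * C.reassoc) := by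
  rw [← C.quasi_coassoc b, Units.inv_mul_cancel_left]

lemma reassoc_inv_eq (hv : IsComoduleAlgebraHom Q.toQuasiBialgebra.regular C v) :
    ((C.reassoc⁻¹ : (B ⊗[k] (H ⊗[k] H))ˣ) : B ⊗[k] (H ⊗[k] H)) =
      Algebra.TensorProduct.map v (AlgHom.id k (H ⊗[k] H)) Q.reassocInv := by
  rw [Units.inv_eq_of_mul_eq_one_right]
  rw [reassoc_eq Q hv, ← map_mul, Q.reassoc_mul_inv, map_one]

lemma contract_reassoc (hv : IsComoduleAlgebraHom Q.toQuasiBialgebra.regular C v) :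
    Q.contract v (C.reassoc : B ⊗[k] (H ⊗[k] H)) = 1 := by
  rw [reassoc_eq Q hv, ← map_one v, ← Q.mulBetaAlpha_reassoc]
  generalize (Q.reassoc : H ⊗[k] (H ⊗[k] H)) = w
  induction w using TensorProduct.induction_on with
  | zero => simp
  | add d e hd he => simp only [map_add, hd, he]
  | tmul c w => simp

/-- `E(b) = X¹ b₀ β S(X² b₁) α X³` -/
lemma proj_eq_contract (hv : IsComoduleAlgebraHom Q.toQuasiBialgebra.regular C v) (b : B) :
    Q.proj C v b = Q.contract v ((C.reassoc : B ⊗[k] (H ⊗[k] H)) * Algebra.TensorProduct.map (AlgHom.id k B)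
      Algebra.TensorProduct.includeLeft (C.coact b)) := by
  rw [reassoc_eq Q hv, proj, qR]
  simp only [LinearMap.comp_apply, AlgHom.toLinearMap_apply]
  generalize (Q.reassoc : H ⊗[k] (H ⊗[k] H)) = w
  generalize C.coact b = d
  induction d using TensorProduct.induction_on with
  | zero => simp
  | add d e hd he => simp only [map_add, mul_add, hd, he]
  | tmul b h =>
  induction w using tensor_induction₃ with
  | zero => simp
  | add d e hd he =>
    simp only [map_add, add_mul, LinearMap.mulLeft_apply] at hd he ⊢
    rw [hd, he]
  | tmul x y z => simp [Q.antipode_mul, mul_assoc]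

/-- `E(b v(h)) = ε(h) E(b)` -/
lemma proj_mul_map (hv : IsComoduleAlgebraHom Q.toQuasiBialgebra.regular C v) (b : B) (h : H) :
    Q.proj C v (b * v h) = Q.counit h • Q.proj C v b := by
  rw [proj_eq_contract Q hv, proj_eq_contract Q hv, map_mul C.coact, coact_map Q hv,
    map_mul (Algebra.TensorProduct.map (AlgHom.id k B) Algebra.TensorProduct.includeLeft),
    ← mul_assoc, contract_mul_includeLeft]

lemma proj_one (hv : IsComoduleAlgebraHom Q.toQuasiBialgebra.regular C v) :
    Q.proj C v 1 = 1 := by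
  rw [proj_eq_contract Q hv, map_one, map_one, mul_one, contract_reassoc Q hv]

/-- The linear map `b ⊗ h ↦ E(b) v(h)`. -/
noncomputable def projMul (C : ComoduleAlgebra Q.toQuasiBialgebra B) (v : H →ₐ[k] B) :
    B ⊗[k] H →ₗ[k] B :=
  LinearMap.mul' k B ∘ₗ TensorProduct.map (Q.proj C v) v.toLinearMap

@[simp] lemma projMul_tmul (b : B) (h : H) :
    Q.projMul C v (b ⊗ₜ[k] h) = Q.proj C v b * v h := rfl

lemma projMul_eq_contract (hv : IsComoduleAlgebraHom Q.toQuasiBialgebra.regular C v)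
    (d : B ⊗[k] H) :
    Q.projMul C v d = Q.contract v ((C.reassoc : B ⊗[k] (H ⊗[k] H)) * Algebra.TensorProduct.assoc k k k B H H
      (Algebra.TensorProduct.map C.coact (AlgHom.id k H) d)) := by
  induction d using TensorProduct.induction_on with
  | zero => simp
  | add d e hd he => simp only [map_add, mul_add, hd, he]
  | tmul b h =>
    rw [projMul_tmul, proj_eq_contract Q hv]
    generalize (C.reassoc : B ⊗[k] (H ⊗[k] H)) = w
    simp only [Algebra.TensorProduct.map_tmul, AlgHom.coe_id, id_eq]
    generalize C.coact b = d
    induction d using TensorProduct.induction_on with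
    | zero => simp
    | add d e hd he => simp only [map_add, mul_add, add_mul, TensorProduct.add_tmul, hd, he]
    | tmul b h =>
    induction w using tensor_induction₃ with
    | zero => simp
    | add d e hd he => simp only [map_add, add_mul, hd, he]
    | tmul x y z => simp [mul_assoc]

/-- `E(x₀ b) v(x₁) = x E(b)` -/
lemma projMul_coact_mul (hv : IsComoduleAlgebraHom Q.toQuasiBialgebra.regular C v) (x b : B) :
    Q.projMul C v (C.coact x * (b ⊗ₜ[k] 1)) = x * Q.proj C v b := by
  have e : Algebra.TensorProduct.assoc k k k B H H
      (Algebra.TensorProduct.map C.coact (AlgHom.id k H) (C.coact x)) =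
      iterLeft C.coact x := rfl
  have e' : Algebra.TensorProduct.assoc k k k B H H (C.coact b ⊗ₜ[k] (1 : H)) =
      Algebra.TensorProduct.map (AlgHom.id k B) Algebra.TensorProduct.includeLeft
        (C.coact b) := by
    generalize C.coact b = d
    induction d using TensorProduct.induction_on with
    | zero => simp
    | add d e hd he => simp only [map_add, TensorProduct.add_tmul, hd, he]
    | tmul b h => simp
  rw [projMul_eq_contract Q hv, map_mul (Algebra.TensorProduct.map C.coact (AlgHom.id k H)),
    map_mul (Algebra.TensorProduct.assoc k k k B H H), e, ← mul_assoc, C.quasi_coassoc, mul_assoc,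
    Algebra.TensorProduct.map_tmul, AlgHom.coe_id, id_eq, e']
  refine (contract_map_comul_mul Q v (C.coact x) _).trans ?_
  rw [epsRight_coact, ← proj_eq_contract Q hv]

/-- `E(b₀) v(b₁) = b` -/
lemma projMul_coact (hv : IsComoduleAlgebraHom Q.toQuasiBialgebra.regular C v) (b : B) :
    Q.projMul C v (C.coact b) = b := by
  have h := Q.projMul_coact_mul hv b 1
  rwa [← Algebra.TensorProduct.one_def, mul_one, proj_one Q hv, mul_one] at h

/-- `E(x E(b)) = E(x b)` -/
lemma proj_mul_proj (hv : IsComoduleAlgebraHom Q.toQuasiBialgebra.regular C v) (x b : B) :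
    Q.proj C v (x * Q.proj C v b) = Q.proj C v (x * b) := by
  have e : ∀ d : B ⊗[k] H, Q.proj C v (x * Q.projMul C v d) =
      Q.proj C v (x * Q.proj C v (Q.epsRight B d)) := by
    intro d
    induction d using TensorProduct.induction_on with
    | zero => simp
    | add d e hd he => simp only [map_add, mul_add, hd, he]
    | tmul b h => rw [projMul_tmul, ← mul_assoc, proj_mul_map Q hv]; simp
  have h := e (C.coact b)
  rwa [projMul_coact Q hv, epsRight_coact, eq_comm] at h

lemma proj_proj (hv : IsComoduleAlgebraHom Q.toQuasiBialgebra.regular C v) (b : B) :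
    Q.proj C v (Q.proj C v b) = Q.proj C v b := by
  simpa using Q.proj_mul_proj hv 1 b

lemma proj_map (hv : IsComoduleAlgebraHom Q.toQuasiBialgebra.regular C v) (h : H) :
    Q.proj C v (v h) = algebraMap k B (Q.counit h) := by
  simpa [proj_one Q hv, Algebra.algebraMap_eq_smul_one] using Q.proj_mul_map hv 1 h

lemma mem_coinvariants_iff (hv : IsComoduleAlgebraHom Q.toQuasiBialgebra.regular C v) (b : B) :
    b ∈ Q.coinvariants C v ↔ Q.proj C v b = b :=
  ⟨by rintro ⟨c, rfl⟩; exact Q.proj_proj hv c, fun h => ⟨b, h⟩⟩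

/-- `(E ⊗ id)(d ρ(v(h))) = (E ⊗ id)(d) (1 ⊗ h)` -/
lemma map_proj_mul_coact_map (hv : IsComoduleAlgebraHom Q.toQuasiBialgebra.regular C v)
    (d : B ⊗[k] H) (h : H) :
    TensorProduct.map (Q.proj C v) LinearMap.id (d * C.coact (v h)) =
      TensorProduct.map (Q.proj C v) LinearMap.id d * (1 ⊗ₜ[k] h) := by
  induction d using TensorProduct.induction_on with
  | zero => simp
  | add d e hd he => simp only [map_add, add_mul, hd, he]
  | tmul b x =>
    have e : ∀ D : H ⊗[k] H, TensorProduct.map (Q.proj C v) LinearMap.id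
        ((b ⊗ₜ[k] x) * Algebra.TensorProduct.map v (AlgHom.id k H) D) =
        Q.proj C v b ⊗ₜ[k] (x * Q.epsLeft H D) := by
      intro D
      induction D using TensorProduct.induction_on with
      | zero => simp
      | add d e hd he => simp only [map_add, mul_add, TensorProduct.tmul_add, hd, he]
      | tmul y z => simp [proj_mul_map Q hv, TensorProduct.smul_tmul]
    rw [coact_map Q hv, e, Q.epsLeft_comul]
    simp

/-- The linear map `b ⊗ x ⊗ y ⊗ z ↦ E(b) ⊗ x β S(y) α z`. -/
noncomputable def projContract (C : ComoduleAlgebra Q.toQuasiBialgebra B) (v : H →ₐ[k] B) :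
    B ⊗[k] (H ⊗[k] (H ⊗[k] H)) →ₗ[k] B ⊗[k] H :=
  TensorProduct.map (Q.proj C v) Q.mulBetaAlpha

@[simp] lemma projContract_tmul (b : B) (w : H ⊗[k] (H ⊗[k] H)) :
    Q.projContract C v (b ⊗ₜ[k] w) = Q.proj C v b ⊗ₜ[k] Q.mulBetaAlpha w := rfl

lemma map_proj_coact_contract (hv : IsComoduleAlgebraHom Q.toQuasiBialgebra.regular C v)
    (w : B ⊗[k] (H ⊗[k] H)) :
    TensorProduct.map (Q.proj C v) LinearMap.id (C.coact (Q.contract v w)) =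
      Q.projContract C v (firstLeg C.coact w) := by
  induction w using TensorProduct.induction_on with
  | zero => simp
  | add d e hd he => simp only [map_add, hd, he]
  | tmul b u =>
    rw [contract_tmul, map_mul, map_proj_mul_coact_map Q hv]
    simp only [firstLeg, AlgHom.comp_apply, Algebra.TensorProduct.map_tmul, AlgHom.coe_id, id_eq]
    generalize C.coact b = d
    induction d using TensorProduct.induction_on with
    | zero => simp
    | add d e hd he => simp only [map_add, add_mul, TensorProduct.add_tmul, hd, he]
    | tmul b h => simp

lemma firstLeg_includeLeft (C : ComoduleAlgebra Q.toQuasiBialgebra B) (d : B ⊗[k] H) :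
    firstLeg C.coact (Algebra.TensorProduct.map (AlgHom.id k B)
      Algebra.TensorProduct.includeLeft d) =
      tensorOne k H B (Algebra.TensorProduct.assoc k k k B H H
        (Algebra.TensorProduct.map C.coact (AlgHom.id k H) d)) := by
  induction d using TensorProduct.induction_on with
  | zero => simp
  | add d e hd he => simp only [map_add, hd, he]
  | tmul b h =>
    simp only [firstLeg, AlgHom.comp_apply, Algebra.TensorProduct.map_tmul, AlgHom.coe_id, id_eq]
    generalize C.coact b = d
    induction d using TensorProduct.induction_on with
    | zero => simp
    | add d e hd he => simp only [map_add, TensorProduct.add_tmul, hd, he]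
    | tmul b h => simp [tensorOne]

lemma tensorOne_tmul (b : B) (w : H ⊗[k] H) : tensorOne k H B (b ⊗ₜ[k] w) =
    b ⊗ₜ[k] Algebra.TensorProduct.assoc k k k H H H (w ⊗ₜ[k] 1) := by
  simp [tensorOne]

lemma projContract_mul_tensorOne_map
    (hv : IsComoduleAlgebraHom Q.toQuasiBialgebra.regular C v)
    (W : B ⊗[k] (H ⊗[k] (H ⊗[k] H))) (w : H ⊗[k] (H ⊗[k] H)) :
    Q.projContract C v (W * tensorOne k H B
        (Algebra.TensorProduct.map v (AlgHom.id k (H ⊗[k] H)) w)) =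
      Q.projContract C v (W * tensorOne k H B (1 ⊗ₜ[k] Q.epsLeft (H ⊗[k] H) w)) := by
  induction W using TensorProduct.induction_on with
  | zero => simp
  | add d e hd he => simp only [map_add, add_mul, hd, he]
  | tmul b u =>
  induction w using TensorProduct.induction_on with
  | zero => simp
  | add d e hd he => simp only [map_add, mul_add, TensorProduct.tmul_add, hd, he]
  | tmul x w =>
    simp [tensorOne_tmul, proj_mul_map Q hv, TensorProduct.smul_tmul']

lemma projContract_mul_tensorOne_map_comul
    (W : B ⊗[k] (H ⊗[k] (H ⊗[k] H))) (d : B ⊗[k] H) :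
    Q.projContract C v (W * tensorOne k H B
        (Algebra.TensorProduct.map (AlgHom.id k B) Q.comul d)) =
      Q.projContract C v (W * (Q.epsRight B d ⊗ₜ[k] 1)) := by
  induction W using TensorProduct.induction_on with
  | zero => simp
  | add d e hd he => simp only [map_add, add_mul, hd, he]
  | tmul b u =>
  induction d using TensorProduct.induction_on with
  | zero => simp
  | add d e hd he => simp only [map_add, mul_add, TensorProduct.add_tmul, hd, he]
  | tmul x w =>
    simp [tensorOne_tmul, mulBetaAlpha_mul_comul, TensorProduct.smul_tmul']

lemma mulBetaAlpha_lastLeg_mul (x y : H) (u : H ⊗[k] (H ⊗[k] H)) :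
    Q.mulBetaAlpha ((x ⊗ₜ[k] Q.comul y) * u) = Q.counit y • (x * Q.mulBetaAlpha u) := by
  induction u using TensorProduct.induction_on with
  | zero => simp
  | add d e hd he => simp only [map_add, mul_add, smul_add, hd, he]
  | tmul p q => simp [betaAlpha_comul_mul, mul_assoc]

lemma projContract_lastLeg_mul (w : H ⊗[k] (H ⊗[k] H)) (W : B ⊗[k] (H ⊗[k] (H ⊗[k] H))) :
    Q.projContract C v (lastLeg B Q.comul
        (Algebra.TensorProduct.map v (AlgHom.id k (H ⊗[k] H)) w) * W) =
      Q.projContract C v (Algebra.TensorProduct.map v Algebra.TensorProduct.includeLeft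
        (Algebra.TensorProduct.map (AlgHom.id k H) (Q.epsRight H) w) * W) := by
  induction W using TensorProduct.induction_on with
  | zero => simp
  | add d e hd he => simp only [map_add, mul_add, hd, he]
  | tmul b u =>
  induction w using tensor_induction₃ with
  | zero => simp
  | add d e hd he => simp only [map_add, add_mul, hd, he]
  | tmul x y z =>
    have e := Q.mulBetaAlpha_lastLeg_mul y 1 u
    rw [map_one, map_one, one_smul] at e
    simp only [lastLeg, Algebra.TensorProduct.map_tmul, AlgHom.coe_id, id_eq,
      Algebra.TensorProduct.tmul_mul_tmul, projContract_tmul, mulBetaAlpha_lastLeg_mul,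
      QuasiBialgebra.epsRight_tmul, map_smul, Algebra.TensorProduct.includeLeft_apply,
      smul_mul_assoc]
    simp [e]

lemma projContract_mul_middleLeg (b c : B) (u w : H ⊗[k] (H ⊗[k] H)) :
    Q.projContract C v ((b ⊗ₜ[k] u) * middleLeg B Q.comul
        (Algebra.TensorProduct.map v (AlgHom.id k (H ⊗[k] H)) w) * (c ⊗ₜ[k] 1)) =
      TensorProduct.map (Q.proj C v) (LinearMap.mulLeft k (Q.mulBetaAlpha u))
        ((b ⊗ₜ[k] 1) * Algebra.TensorProduct.map v (AlgHom.id k H)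
          (Algebra.TensorProduct.map (AlgHom.id k H) (Q.epsLeft H) w) * (c ⊗ₜ[k] 1)) := by
  induction w using tensor_induction₃ with
  | zero => simp
  | add d e hd he => simp only [map_add, add_mul, mul_add, hd, he]
  | tmul x y z => simp [middleLeg, mulBetaAlpha_mul_comul]

/-- `E(E(c)₀) ⊗ E(c)₁ = E(c) ⊗ 1` -/
lemma map_proj_coact_proj (hv : IsComoduleAlgebraHom Q.toQuasiBialgebra.regular C v) (c : B) :
    TensorProduct.map (Q.proj C v) LinearMap.id (C.coact (Q.proj C v c)) =
      Q.proj C v c ⊗ₜ[k] 1 := by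
  have e : Algebra.TensorProduct.assoc k k k B H H
      (Algebra.TensorProduct.map C.coact (AlgHom.id k H) (C.coact c)) =
      iterLeft C.coact c := rfl
  have e' : iterRight Q.comul C.coact c =
    Algebra.TensorProduct.map (AlgHom.id k B) Q.comul (C.coact c) := rfl
  have p : firstLeg C.coact (C.reassoc : B ⊗[k] (H ⊗[k] H)) * tensorOne k H B
      ((C.reassoc⁻¹ : (B ⊗[k] (H ⊗[k] H))ˣ) : B ⊗[k] (H ⊗[k] H)) =
      lastLeg B Q.comul ((C.reassoc⁻¹ : (B ⊗[k] (H ⊗[k] H))ˣ) : B ⊗[k] (H ⊗[k] H)) *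
        (oneTensor k H B (Q.reassoc : H ⊗[k] (H ⊗[k] H)) *
          middleLeg B Q.comul (C.reassoc : B ⊗[k] (H ⊗[k] H))) := by
    have i1 : lastLeg B Q.comul
        ((C.reassoc⁻¹ : (B ⊗[k] (H ⊗[k] H))ˣ) : B ⊗[k] (H ⊗[k] H)) *
        lastLeg B Q.comul (C.reassoc : B ⊗[k] (H ⊗[k] H)) = 1 := by
      rw [← map_mul, Units.inv_mul, map_one]
    have i2 : tensorOne k H B (C.reassoc : B ⊗[k] (H ⊗[k] H)) * tensorOne k H B
        ((C.reassoc⁻¹ : (B ⊗[k] (H ⊗[k] H))ˣ) : B ⊗[k] (H ⊗[k] H)) = 1 := by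
      rw [← map_mul, Units.mul_inv, map_one]
    have q := C.pentagon
    generalize firstLeg C.coact (C.reassoc : B ⊗[k] (H ⊗[k] H)) = x1 at *
    generalize lastLeg B Q.comul (C.reassoc : B ⊗[k] (H ⊗[k] H)) = x2 at *
    generalize lastLeg B Q.comul
      ((C.reassoc⁻¹ : (B ⊗[k] (H ⊗[k] H))ˣ) : B ⊗[k] (H ⊗[k] H)) = y2 at *
    generalize tensorOne k H B (C.reassoc : B ⊗[k] (H ⊗[k] H)) = x3 at *
    generalize tensorOne k H B
      ((C.reassoc⁻¹ : (B ⊗[k] (H ⊗[k] H))ˣ) : B ⊗[k] (H ⊗[k] H)) = y3 at *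
    generalize middleLeg B Q.comul (C.reassoc : B ⊗[k] (H ⊗[k] H)) = x4 at *
    generalize oneTensor k H B (Q.reassoc : H ⊗[k] (H ⊗[k] H)) = x5 at *
    calc x1 * y3 = y2 * x2 * x1 * y3 := by rw [i1, one_mul]
      _ = y2 * (x2 * x1) * y3 := by simp only [mul_assoc]
      _ = y2 * (x5 * x4) * (x3 * y3) := by rw [← q]; simp only [mul_assoc]
      _ = y2 * (x5 * x4) := by rw [i2, mul_one]
  rw [proj_eq_contract Q hv c, map_proj_coact_contract Q hv, map_mul (firstLeg C.coact),
    firstLeg_includeLeft, e,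
    iterLeft_coact, map_mul (tensorOne k H B), map_mul (tensorOne k H B), ← mul_assoc, p,
    ← mul_assoc]
  generalize hW : lastLeg B Q.comul
      ((C.reassoc⁻¹ : (B ⊗[k] (H ⊗[k] H))ˣ) : B ⊗[k] (H ⊗[k] H)) *
        (oneTensor k H B (Q.reassoc : H ⊗[k] (H ⊗[k] H)) *
          middleLeg B Q.comul (C.reassoc : B ⊗[k] (H ⊗[k] H))) = W
  rw [reassoc_eq Q hv, projContract_mul_tensorOne_map Q hv, Q.epsLeft_one,
    ← Algebra.TensorProduct.one_def, map_one, mul_one, e',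
    projContract_mul_tensorOne_map_comul, epsRight_coact, ← hW, reassoc_inv_eq Q hv,
    mul_assoc, projContract_lastLeg_mul, Q.epsRight_reassocInv, map_one, one_mul,
    reassoc_eq Q hv, oneTensor, Algebra.TensorProduct.includeRight_apply,
    projContract_mul_middleLeg, Q.epsMiddle, mulBetaAlpha_reassoc,
    ← Algebra.TensorProduct.one_def, map_one, one_mul, one_mul,
    TensorProduct.map_tmul, LinearMap.mulLeft_apply, one_mul, ← reassoc_eq Q hv,
    ← proj_eq_contract Q hv]

lemma mem_coinvariants_iff_coact (hv : IsComoduleAlgebraHom Q.toQuasiBialgebra.regular C v)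
    (b : B) : b ∈ Q.coinvariants C v ↔
      TensorProduct.map (Q.proj C v) LinearMap.id (C.coact b) = Q.proj C v b ⊗ₜ[k] (1 : H) := by
  constructor
  · rintro ⟨c, rfl⟩
    rw [map_proj_coact_proj Q hv, proj_proj Q hv]
  · intro h
    have e : ∀ d : B ⊗[k] H, LinearMap.mul' k B (TensorProduct.map LinearMap.id v.toLinearMap
        (TensorProduct.map (Q.proj C v) LinearMap.id d)) = Q.projMul C v d := by
      intro d
      induction d using TensorProduct.induction_on with
      | zero => simp
      | add d e hd he => simp only [map_add, hd, he]
      | tmul b h => simp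
    have h' := e (C.coact b)
    rw [h, projMul_coact Q hv] at h'
    exact ⟨b, by simpa using h'⟩

/-- The linear map `b ⊗ x ⊗ y ↦ E(b) v(x) ⊗ y`. -/
noncomputable def projMulTensor (C : ComoduleAlgebra Q.toQuasiBialgebra B) (v : H →ₐ[k] B) :
    B ⊗[k] (H ⊗[k] H) →ₗ[k] B ⊗[k] H :=
  TensorProduct.map (Q.projMul C v) LinearMap.id ∘ₗ
    (TensorProduct.assoc k B H H).symm.toLinearMap

@[simp] lemma projMulTensor_tmul (b : B) (x y : H) :
    Q.projMulTensor C v (b ⊗ₜ[k] (x ⊗ₜ[k] y)) = (Q.proj C v b * v x) ⊗ₜ[k] y := rfl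

lemma projMulTensor_iterLeft (hv : IsComoduleAlgebraHom Q.toQuasiBialgebra.regular C v) (b : B) :
    Q.projMulTensor C v (iterLeft C.coact b) = C.coact b := by
  have e : ∀ d : B ⊗[k] H, Q.projMulTensor C v (Algebra.TensorProduct.assoc k k k B H H
      (Algebra.TensorProduct.map C.coact (AlgHom.id k H) d)) = d := by
    intro d
    induction d using TensorProduct.induction_on with
    | zero => simp
    | add d e hd he => simp only [map_add, hd, he]
    | tmul b h =>
      have e' : ∀ d : B ⊗[k] H, Q.projMulTensor C v (Algebra.TensorProduct.assoc k k k B H H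
          (d ⊗ₜ[k] h)) = Q.projMul C v d ⊗ₜ[k] h := by
        intro d
        induction d using TensorProduct.induction_on with
        | zero => simp
        | add d e hd he => simp only [map_add, TensorProduct.add_tmul, hd, he]
        | tmul b h => simp
      rw [Algebra.TensorProduct.map_tmul, AlgHom.coe_id, id_eq, e', projMul_coact Q hv]
  exact e _

lemma projMulTensor_mul_map (hv : IsComoduleAlgebraHom Q.toQuasiBialgebra.regular C v)
    (W : B ⊗[k] (H ⊗[k] H)) (w : H ⊗[k] (H ⊗[k] H)) :
    Q.projMulTensor C v (W * Algebra.TensorProduct.map v (AlgHom.id k (H ⊗[k] H)) w) =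
      Q.projMulTensor C v (W * (1 ⊗ₜ[k] Q.epsLeft (H ⊗[k] H) w)) := by
  induction W using tensor_induction₃ with
  | zero => simp
  | add d e hd he => simp only [map_add, add_mul, hd, he]
  | tmul b p q =>
  induction w using tensor_induction₃ with
  | zero => simp
  | add d e hd he => simp only [map_add, mul_add, TensorProduct.tmul_add, hd, he]
  | tmul x y z => simp [proj_mul_map Q hv, TensorProduct.smul_tmul']

lemma projMulTensor_mul_proj_tmul (hv : IsComoduleAlgebraHom Q.toQuasiBialgebra.regular C v)
    (x b : B) (w : H ⊗[k] H) :
    Q.projMulTensor C v ((x * Q.proj C v b) ⊗ₜ[k] w) =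
      Q.projMulTensor C v ((x * b) ⊗ₜ[k] w) := by
  induction w using TensorProduct.induction_on with
  | zero => simp
  | add d e hd he => simp only [map_add, TensorProduct.tmul_add, hd, he]
  | tmul y z => simp [proj_mul_proj Q hv]

lemma projMulTensor_mul_map_comul (hv : IsComoduleAlgebraHom Q.toQuasiBialgebra.regular C v)
    (W : B ⊗[k] (H ⊗[k] H)) (d : B ⊗[k] H) :
    Q.projMulTensor C v (W * Algebra.TensorProduct.map (AlgHom.id k B) Q.comul
        (TensorProduct.map (Q.proj C v) LinearMap.id d)) =
      Q.projMulTensor C v (W * Algebra.TensorProduct.map (AlgHom.id k B) Q.comul d) := by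
  induction W using TensorProduct.induction_on with
  | zero => simp
  | add d e hd he => simp only [map_add, add_mul, hd, he]
  | tmul b w =>
  induction d using TensorProduct.induction_on with
  | zero => simp
  | add d e hd he => simp only [map_add, mul_add, hd, he]
  | tmul x y => simp [projMulTensor_mul_proj_tmul Q hv]

/-- `ρ(a) = E(v(x¹) a) v(x²) ⊗ x³` for coinvariant `a`, where `Φ⁻¹ = x¹ ⊗ x² ⊗ x³` -/
lemma coact_coinvariants (hv : IsComoduleAlgebraHom Q.toQuasiBialgebra.regular C v)
    (a : Q.coinvariants C v) :
    C.coact (a : B) = Q.projMulTensor C v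
      (Algebra.TensorProduct.map v (AlgHom.id k (H ⊗[k] H)) Q.reassocInv *
        ((a : B) ⊗ₜ[k] 1)) := by
  have e' : iterRight Q.comul C.coact (a : B) =
    Algebra.TensorProduct.map (AlgHom.id k B) Q.comul (C.coact (a : B)) := rfl
  rw [← projMulTensor_iterLeft Q hv, iterLeft_coact, ← mul_assoc, reassoc_eq Q hv,
    projMulTensor_mul_map Q hv, Q.epsLeft_one, ← Algebra.TensorProduct.one_def, mul_one, e',
    ← projMulTensor_mul_map_comul Q hv, (Q.mem_coinvariants_iff_coact hv _).1 a.2,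
    (Q.mem_coinvariants_iff hv _).1 a.2, Algebra.TensorProduct.map_tmul, map_one,
    reassoc_inv_eq Q hv]
  rfl

/-- The linear map `h ↦ E(v(h) b)`. -/
noncomputable def projAct (C : ComoduleAlgebra Q.toQuasiBialgebra B) (v : H →ₐ[k] B) (b : B) :
    H →ₗ[k] B :=
  Q.proj C v ∘ₗ LinearMap.mulRight k b ∘ₗ v.toLinearMap

/-- The linear map `x ⊗ y ⊗ z ↦ E(E(v(x) a) E(v(y) b)) v(z)`. -/
noncomputable def smashProd (C : ComoduleAlgebra Q.toQuasiBialgebra B) (v : H →ₐ[k] B)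
    (a b : B) : H ⊗[k] (H ⊗[k] H) →ₗ[k] B :=
  Q.projMul C v ∘ₗ TensorProduct.map (LinearMap.mul' k B) LinearMap.id ∘ₗ
    (TensorProduct.assoc k B B H).symm.toLinearMap ∘ₗ
    TensorProduct.map (Q.projAct C v a) (TensorProduct.map (Q.projAct C v b) LinearMap.id)

@[simp] lemma smashProd_tmul (a b : B) (x y z : H) :
    Q.smashProd C v a b (x ⊗ₜ[k] (y ⊗ₜ[k] z)) =
      Q.proj C v (Q.proj C v (v x * a) * Q.proj C v (v y * b)) * v z := rfl

/-- `a b = E(E(v(x¹) a) E(v(x²) b)) v(x³)` for coinvariant `a` and `b` -/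
lemma smashProd_reassocInv (hv : IsComoduleAlgebraHom Q.toQuasiBialgebra.regular C v)
    (a b : Q.coinvariants C v) :
    Q.smashProd C v (a : B) (b : B) Q.reassocInv = (a : B) * (b : B) := by
  have e : ∀ w, Q.projMul C v (Q.projMulTensor C v
      (Algebra.TensorProduct.map v (AlgHom.id k (H ⊗[k] H)) w * ((a : B) ⊗ₜ[k] 1)) *
        ((b : B) ⊗ₜ[k] 1)) = Q.smashProd C v (a : B) (b : B) w := by
    intro w
    induction w using tensor_induction₃ with
    | zero => simp
    | add d e hd he => simp only [map_add, add_mul, hd, he]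
    | tmul x y z => simp [mul_assoc, proj_mul_proj Q hv]
  rw [← e, ← coact_coinvariants Q hv, projMul_coact_mul Q hv,
    (Q.mem_coinvariants_iff hv _).1 b.2]

lemma smashProd_mul_tmul (hv : IsComoduleAlgebraHom Q.toQuasiBialgebra.regular C v)
    (a b : B) (w : H ⊗[k] (H ⊗[k] H)) (x y z : H) :
    Q.smashProd C v a b (w * (x ⊗ₜ[k] (y ⊗ₜ[k] z))) =
      Q.smashProd C v (Q.proj C v (v x * a)) (Q.proj C v (v y * b)) w * v z := by
  induction w using tensor_induction₃ with
  | zero => simp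
  | add d e hd he => simp only [map_add, add_mul, hd, he]
  | tmul p q r => simp [mul_assoc, proj_mul_proj Q hv]

/-- The map `E`, from `B` to the coinvariants. -/
noncomputable def toCoinvariants (C : ComoduleAlgebra Q.toQuasiBialgebra B) (v : H →ₐ[k] B) :
    B →ₗ[k] Q.coinvariants C v :=
  (Q.proj C v).rangeRestrict

@[simp] lemma coe_toCoinvariants (b : B) : (Q.toCoinvariants C v b : B) = Q.proj C v b := rfl

lemma proj_coe (hv : IsComoduleAlgebraHom Q.toQuasiBialgebra.regular C v)
    (a : Q.coinvariants C v) : Q.proj C v (a : B) = a :=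
  (Q.mem_coinvariants_iff hv _).1 a.2

/-- The multiplication `a * b = E(a b)` of coinvariants. -/
noncomputable def coinvariantsMul (C : ComoduleAlgebra Q.toQuasiBialgebra B) (v : H →ₐ[k] B) :
    Q.coinvariants C v →ₗ[k] Q.coinvariants C v →ₗ[k] Q.coinvariants C v :=
  LinearMap.mk₂ k (fun a b => Q.toCoinvariants C v ((a : B) * (b : B)))
    (fun _ _ _ => by simp [add_mul]) (fun _ _ _ => by simp)
    (fun _ _ _ => by simp [mul_add]) (fun _ _ _ => by simp)

@[simp] lemma coe_coinvariantsMul (a b : Q.coinvariants C v) :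
    (Q.coinvariantsMul C v a b : B) = Q.proj C v ((a : B) * (b : B)) := rfl

/-- The action `h ▷ a = E(v(h) a)` on coinvariants. -/
noncomputable def coinvariantsAct (hv : IsComoduleAlgebraHom Q.toQuasiBialgebra.regular C v) :
    H →ₐ[k] Module.End k (Q.coinvariants C v) :=
  AlgHom.ofLinearMap
    (LinearMap.mk₂ k (fun h a => Q.toCoinvariants C v (v h * (a : B)))
      (fun _ _ _ => by simp [add_mul]) (fun _ _ _ => by simp)
      (fun _ _ _ => by simp [mul_add]) (fun _ _ _ => by simp))
    (by
      ext a
      simp [proj_coe Q hv])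
    (by
      intro g h
      ext a
      simp [mul_assoc, proj_mul_proj Q hv])

@[simp] lemma coe_coinvariantsAct (hv : IsComoduleAlgebraHom Q.toQuasiBialgebra.regular C v)
    (h : H) (a : Q.coinvariants C v) :
    (Q.coinvariantsAct hv h a : B) = Q.proj C v (v h * (a : B)) := rfl

/-- The coinvariants as a left `H`-module algebra. -/
noncomputable def coinvariantsModuleAlgebra
    (hv : IsComoduleAlgebraHom Q.toQuasiBialgebra.regular C v) :
    ModuleAlgebra Q.toQuasiBialgebra (Q.coinvariants C v) where
  act := Q.coinvariantsAct hv
  mul := Q.coinvariantsMul C v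
  one := ⟨1, 1, Q.proj_one hv⟩
  one_mul a := by
    ext
    simp [proj_coe Q hv]
  mul_one a := by
    ext
    simp [proj_coe Q hv]
  mul_assoc a b c := by
    ext
    have e : ∀ w : H ⊗[k] (H ⊗[k] H), ((TensorProduct.lift (Q.coinvariantsMul C v)
        (TensorProduct.map ((Q.coinvariantsAct hv).toLinearMap.flip a)
        (TensorProduct.lift (Q.coinvariantsMul C v) ∘ₗ
        TensorProduct.map ((Q.coinvariantsAct hv).toLinearMap.flip b)
          ((Q.coinvariantsAct hv).toLinearMap.flip c)) w) : Q.coinvariants C v) : B) =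
        Q.proj C v (Q.smashProd C v (a : B) (b : B) (Q.reassocInv * w) * c) := by
      intro w
      induction w using tensor_induction₃ with
      | zero => simp
      | add d e hd he => simp only [map_add, mul_add, add_mul, Submodule.coe_add, hd, he]
      | tmul x y z =>
        rw [smashProd_mul_tmul Q hv]
        have := Q.smashProd_reassocInv hv (Q.toCoinvariants C v (v x * a))
          (Q.toCoinvariants C v (v y * b))
        rw [coe_toCoinvariants, coe_toCoinvariants] at this
        rw [this]
        simp [proj_mul_proj Q hv, mul_assoc]
    rw [e, Q.reassocInv_mul, Algebra.TensorProduct.one_def, Algebra.TensorProduct.one_def]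
    simp [proj_coe Q hv]
  act_mul h a b := by
    ext
    have e : ∀ D : H ⊗[k] H, ((TensorProduct.lift (Q.coinvariantsMul C v)
        (TensorProduct.map ((Q.coinvariantsAct hv).toLinearMap.flip a)
        ((Q.coinvariantsAct hv).toLinearMap.flip b) D) : Q.coinvariants C v) : B) =
        Q.proj C v (Q.projMul C v (Algebra.TensorProduct.map v (AlgHom.id k H) D *
          ((a : B) ⊗ₜ[k] 1)) * b) := by
      intro D
      induction D using TensorProduct.induction_on with
      | zero => simp
      | add d e hd he => simp only [map_add, add_mul, Submodule.coe_add, hd, he]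
      | tmul x y => simp [proj_mul_proj Q hv, mul_assoc]
    rw [e, ← coact_map Q hv, projMul_coact_mul Q hv]
    simp [proj_mul_proj Q hv, proj_coe Q hv, mul_assoc]
  act_one h := by
    ext
    simp [proj_map Q hv, Algebra.algebraMap_eq_smul_one]

/-- The linear isomorphism `a ⊗ h ↦ a v(h)`, with inverse `b ↦ E(b₀) ⊗ b₁`. -/
noncomputable def coinvariantsTensorEquiv
    (hv : IsComoduleAlgebraHom Q.toQuasiBialgebra.regular C v) :
    Q.coinvariants C v ⊗[k] H ≃ₗ[k] B :=
  LinearEquiv.ofLinearMap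
    (LinearMap.mul' k B ∘ₗ TensorProduct.map (Q.coinvariants C v).subtype v.toLinearMap)
    (TensorProduct.map (Q.toCoinvariants C v) LinearMap.id ∘ₗ C.coact.toLinearMap)
    (by
      ext b
      have e : ∀ d : B ⊗[k] H, LinearMap.mul' k B (TensorProduct.map
          (Q.coinvariants C v).subtype v.toLinearMap
          (TensorProduct.map (Q.toCoinvariants C v) LinearMap.id d)) = Q.projMul C v d := by
        intro d
        induction d using TensorProduct.induction_on with
        | zero => simp
        | add d e hd he => simp only [map_add, hd, he]
        | tmul b h => simp
      exact (e _).trans (projMul_coact Q hv b))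
    (by
      apply TensorProduct.ext'
      intro a h
      have i : Function.Injective (TensorProduct.map (Q.coinvariants C v).subtype
          (LinearMap.id : H →ₗ[k] H)) :=
        Module.Flat.rTensor_preserves_injective_linearMap _ (Submodule.injective_subtype _)
      apply i
      have e : ∀ d : B ⊗[k] H, TensorProduct.map (Q.coinvariants C v).subtype LinearMap.id
          (TensorProduct.map (Q.toCoinvariants C v) LinearMap.id d) =
          TensorProduct.map (Q.proj C v) LinearMap.id d := by
        intro d
        rw [← LinearMap.comp_apply, ← TensorProduct.map_comp]
        rfl
      refine (e _).trans ?_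
      change TensorProduct.map (Q.proj C v) LinearMap.id (C.coact ((a : B) * v h)) = _
      rw [map_mul, map_proj_mul_coact_map Q hv, (Q.mem_coinvariants_iff_coact hv _).1 a.2,
        proj_coe Q hv]
      simp)

@[simp] lemma coinvariantsTensorEquiv_tmul
    (hv : IsComoduleAlgebraHom Q.toQuasiBialgebra.regular C v)
    (a : Q.coinvariants C v) (h : H) :
    Q.coinvariantsTensorEquiv hv (a ⊗ₜ[k] h) = (a : B) * v h := rfl

lemma coinvariantsTensorEquiv_mulTensor
    (hv : IsComoduleAlgebraHom Q.toQuasiBialgebra.regular C v)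
    (a b : Q.coinvariants C v) (w : H ⊗[k] (H ⊗[k] H)) :
    Q.coinvariantsTensorEquiv hv ((Q.coinvariantsModuleAlgebra hv).mulTensor a b w) =
      Q.smashProd C v (a : B) (b : B) w := by
  induction w using tensor_induction₃ with
  | zero => simp
  | add d e hd he => simp only [map_add, hd, he]
  | tmul x y z => rfl

lemma coinvariantsTensorEquiv_smashMul
    (hv : IsComoduleAlgebraHom Q.toQuasiBialgebra.regular C v) (x y : Q.coinvariants C v ⊗[k] H) :
    Q.coinvariantsTensorEquiv hv ((Q.coinvariantsModuleAlgebra hv).smashMul x y) =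
      Q.coinvariantsTensorEquiv hv x * Q.coinvariantsTensorEquiv hv y := by
  induction x using TensorProduct.induction_on with
  | zero => simp
  | add x x' h h' => simp only [map_add, LinearMap.add_apply, add_mul, h, h']
  | tmul a h =>
  induction y using TensorProduct.induction_on with
  | zero => simp
  | add x x' h h' => simp only [map_add, mul_add, h, h']
  | tmul b g =>
    have e : ∀ D : H ⊗[k] H, Q.smashProd C v (a : B) (b : B)
        (Q.reassocInv * ((1 : H) ⊗ₜ[k] (D * ((1 : H) ⊗ₜ[k] g)))) =
        a * Q.projMul C v (Algebra.TensorProduct.map v (AlgHom.id k H) D *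
          ((b : B) ⊗ₜ[k] 1)) * v g := by
      intro D
      induction D using TensorProduct.induction_on with
      | zero => simp
      | add d e hd he => simp only [map_add, add_mul, mul_add, TensorProduct.tmul_add, hd, he]
      | tmul d e =>
        have := Q.smashProd_reassocInv hv a (Q.toCoinvariants C v (v d * b))
        rw [coe_toCoinvariants] at this
        rw [Algebra.TensorProduct.tmul_mul_tmul, smashProd_mul_tmul Q hv, map_one, one_mul,
          mul_one, proj_coe Q hv, this]
        simp [mul_assoc]
    rw [ModuleAlgebra.smashMul_tmul, coinvariantsTensorEquiv_mulTensor, e, ← coact_map Q hv,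
      projMul_coact_mul Q hv, proj_coe Q hv]
    simp [mul_assoc]

/-- The algebra isomorphism `Ψ(a # h) = a v(h)`. -/
noncomputable def smashEquiv (hv : IsComoduleAlgebraHom Q.toQuasiBialgebra.regular C v) :
    (Q.coinvariantsModuleAlgebra hv).Smash ≃ₐ[k] B :=
  AlgEquiv.ofLinearEquiv
    ((Q.coinvariantsModuleAlgebra hv).toSmash.symm.trans (Q.coinvariantsTensorEquiv hv))
    (by
      change (1 : B) * v 1 = 1
      simp)
    (Q.coinvariantsTensorEquiv_smashMul hv)

@[simp] lemma smashEquiv_smash (hv : IsComoduleAlgebraHom Q.toQuasiBialgebra.regular C v)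
    (a : Q.coinvariants C v) (h : H) :
    Q.smashEquiv hv ((Q.coinvariantsModuleAlgebra hv).smash a h) = (a : B) * v h := rfl

lemma map_smashEquiv_coactTensor
    (hv : IsComoduleAlgebraHom Q.toQuasiBialgebra.regular C v)
    (a : Q.coinvariants C v) (w : H ⊗[k] (H ⊗[k] H)) (D : H ⊗[k] H) :
    Algebra.TensorProduct.map (Q.smashEquiv hv : _ →ₐ[k] B) (AlgHom.id k H)
        ((Q.coinvariantsModuleAlgebra hv).coactTensor a (w * ((1 : H) ⊗ₜ[k] D))) =
      Q.projMulTensor C v (Algebra.TensorProduct.map v (AlgHom.id k (H ⊗[k] H)) w *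
        ((a : B) ⊗ₜ[k] 1)) * Algebra.TensorProduct.map v (AlgHom.id k H) D := by
  induction D using TensorProduct.induction_on with
  | zero => simp
  | add d e hd he => simp only [map_add, mul_add, TensorProduct.tmul_add, hd, he]
  | tmul d e =>
  induction w using tensor_induction₃ with
  | zero => simp
  | add d e hd he => simp only [map_add, add_mul, hd, he]
  | tmul x y z =>
    have h : (Q.coinvariantsModuleAlgebra hv).act = Q.coinvariantsAct hv := rfl
    simp [h, mul_assoc]

lemma isComoduleAlgebraHom_smashEquiv
    (hv : IsComoduleAlgebraHom Q.toQuasiBialgebra.regular C v) :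
    IsComoduleAlgebraHom (Q.coinvariantsModuleAlgebra hv).smashComodule C
      (Q.smashEquiv hv : (Q.coinvariantsModuleAlgebra hv).Smash →ₐ[k] B) where
  map_coact x := by
    obtain ⟨y, rfl⟩ := (Q.coinvariantsModuleAlgebra hv).toSmash.surjective x
    induction y using TensorProduct.induction_on with
    | zero => simp
    | add x y hx hy => simp only [map_add, hx, hy]
    | tmul a h =>
      refine Eq.trans ?_ (Q.map_smashEquiv_coactTensor hv a _ _).symm
      change C.coact ((a : B) * v h) = _
      rw [map_mul, coact_coinvariants Q hv, coact_map Q hv]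
  map_reassoc := by
    rw [reassoc_eq Q hv]
    change _ = Algebra.TensorProduct.map _ _ (Algebra.TensorProduct.map
      (Q.coinvariantsModuleAlgebra hv).inclusion (AlgHom.id k (H ⊗[k] H))
      (Q.reassoc : H ⊗[k] (H ⊗[k] H)))
    generalize (Q.reassoc : H ⊗[k] (H ⊗[k] H)) = w
    induction w using TensorProduct.induction_on with
    | zero => simp
    | add d e hd he => simp only [map_add, hd, he]
    | tmul x y =>
      have h : ((Q.coinvariantsModuleAlgebra hv).one : B) = 1 := rfl
      simp [h]

end QuasiHopfAlgebra

end QuasiHopf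

theorem mainTheorem1 {k H B : Type*} [Field k] [Ring H] [Algebra k H] [Ring B] [Algebra k B]
    (Q : QuasiHopf.QuasiHopfAlgebra k H)
    (C : QuasiHopf.ComoduleAlgebra Q.toQuasiBialgebra B)
    (v : H →ₐ[k] B)
    (hv : QuasiHopf.IsComoduleAlgebraHom Q.toQuasiBialgebra.regular C v) :
    (∀ b : B, b ∈ Q.coinvariants C v ↔ Q.proj C v b = b) ∧
    (∀ b : B, b ∈ Q.coinvariants C v ↔
      TensorProduct.map (Q.proj C v) LinearMap.id (C.coact b) =
        Q.proj C v b ⊗ₜ[k] (1 : H)) ∧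
    ∃ M : QuasiHopf.ModuleAlgebra Q.toQuasiBialgebra (Q.coinvariants C v),
      (∀ a a' : Q.coinvariants C v, (M.mul a a' : B) = Q.proj C v ((a : B) * (a' : B))) ∧
      (M.one : B) = 1 ∧
      (∀ (h : H) (a : Q.coinvariants C v), (M.act h a : B) = Q.proj C v (v h * (a : B))) ∧
      ∃ Ψ : M.Smash ≃ₐ[k] B,
        (∀ (a : Q.coinvariants C v) (h : H), Ψ (M.smash a h) = (a : B) * v h) ∧
        QuasiHopf.IsComoduleAlgebraHom M.smashComodule C (Ψ : M.Smash →ₐ[k] B) :=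
  ⟨Q.mem_coinvariants_iff hv, Q.mem_coinvariants_iff_coact hv, Q.coinvariantsModuleAlgebra hv,
    fun _ _ => rfl, rfl, fun _ _ => rfl, Q.smashEquiv hv, fun _ _ => rfl,
    Q.isComoduleAlgebraHom_smashEquiv hv⟩
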